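/- Let $T>0$, $0\le s\le T$, $n\in\mathbb N$, and let $f:\mathbb R^n\times[0,T]\to\mathbb R^n$ be such that, for each $t\in[0,T]$, the partial derivatives of $f(\cdot,t)$ in $x$ up to second order exist everywhere, and such that $f$ and these derivatives are Lebesgue measurable in $(x,t)$ and bounded on $\mathbb R^n\times[0,T]$. Write $H^0=L_2(\mathbb R^n)$, $H^1=W_2^1(\mathbb R^n)$ (real-valued), and let $A^*(\cdot,t)v=-\sum_{i=1}^n\frac{\partial}{\partial x_i}\bigl(f_i(\cdot,t)\,v\bigr)$, with weak derivatives, for $v\in H^1$. For $\rho_0\in H^1$, a solution of the Cauchy problem $$\frac{\partial p}{\partial t}(x,t)=A^*(x,t)p(x,t)\quad(s<t\le T),\qquad p(x,s)=\rho_0(x),\qquad(\ast)$$ is a function $p\in L^2([s,T]\to H^1)\cap C([s,T]\to H^0)$ for which there is $q\in L^2([s,T]\to H^0)$ with $q(t)=A^*(\cdot,t)p(t)$ for almost all $t$ and $p(t)=\rho_0+\int_s^t q(r)\,dr$ for all $t\in[s,T]$. Then: 1. There is exactly one continuous linear operator $\mathcal L_s^*:H^0\to C([s,T]\to H^0)$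 such that, for every $\rho_0\in H^1$, $\mathcal L_s^*\rho_0$ is the one and only solution of $(\ast)$. 2. For each $x\in\mathbb R^n$ the problem $$\frac{dy}{dt}(t)=f[y(t),t]\quad\text{on }[s,T],\qquad y(s)=x,$$ has exactly one absolutely continuous solution (that is, $y(t)=x+\int_s^t f[y(r),r]\,dr$ for $t\in[s,T]$). 3. If $a=a(\omega)$ is a random $n$-vector on a probability space $(\Omega,\mathcal F,P)$ with probability density $\rho_s\in H^0$, and $y^{a,s}(t)$ is the random process which for each $\omega$ solves the problem in 2 with $y(s)=a(\omega)$, then $\rho=\mathcal L_s^*\rho_s\in C([s,T]\to H^0)$ is the probability density of $y^{a,s}(t)$: for every $t\in[s,T]$, $y^{a,s}(t)$ is a random vector with probability density $\rho(\cdot,t)$. -/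

import Mathlib

open MeasureTheory
open scoped ContDiff

noncomputable section

/-- The real Hilbert space `H⁰ = L₂(ℝⁿ)`. -/
abbrev H0 (n : ℕ) : Type :=
  Lp ℝ 2 (volume : Measure (EuclideanSpace ℝ (Fin n)))

/-- The classical partial derivative `∂u/∂xᵢ` (meaningful where `LineDifferentiableAt` holds). -/
def partialDeriv {n : ℕ} (i : Fin n) (u : EuclideanSpace ℝ (Fin n) → ℝ)
    (x : EuclideanSpace ℝ (Fin n)) : ℝ :=
  lineDeriv ℝ u x (EuclideanSpace.single i 1)

/-- `u` has a classical partial derivative `∂u/∂xᵢ` at every point. -/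
def HasPartialDeriv {n : ℕ} (i : Fin n) (u : EuclideanSpace ℝ (Fin n) → ℝ) : Prop :=
  ∀ x, LineDifferentiableAt ℝ u x (EuclideanSpace.single i 1)

/-- Standing assumptions on the right-hand side `f : ℝⁿ × [0,T] → ℝⁿ`: for each `t` the partial
`x`-derivatives of `f(·, t)` up to the second order exist everywhere, and `f` and these derivatives
are Lebesgue measurable in `(x, t)` and bounded, uniformly in `x` and `t ∈ [0,T]`.
(With respect to a restriction of Lebesgue measure, `AEMeasurable` is Lebesgue measurability.) -/
structure IsRegularField {n : ℕ} (T : ℝ)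
    (f : EuclideanSpace ℝ (Fin n) → ℝ → EuclideanSpace ℝ (Fin n)) : Prop where
  diff_one : ∀ t ∈ Set.Icc 0 T, ∀ i j, HasPartialDeriv j (fun x => f x t i)
  diff_two : ∀ t ∈ Set.Icc 0 T, ∀ i j k,
    HasPartialDeriv k (partialDeriv j (fun x => f x t i))
  meas_zero : ∀ i, AEMeasurable
    (fun z : EuclideanSpace ℝ (Fin n) × ℝ => f z.1 z.2 i)
    (volume.restrict (Set.univ ×ˢ Set.Icc 0 T))
  meas_one : ∀ i j, AEMeasurable
    (fun z : EuclideanSpace ℝ (Fin n) × ℝ => partialDeriv j (fun x => f x z.2 i) z.1)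
    (volume.restrict (Set.univ ×ˢ Set.Icc 0 T))
  meas_two : ∀ i j k, AEMeasurable
    (fun z : EuclideanSpace ℝ (Fin n) × ℝ =>
      partialDeriv k (partialDeriv j (fun x => f x z.2 i)) z.1)
    (volume.restrict (Set.univ ×ˢ Set.Icc 0 T))
  bdd : ∃ K : ℝ, ∀ t ∈ Set.Icc 0 T, ∀ x,
    (∀ i, |f x t i| ≤ K) ∧
    (∀ i j, |partialDeriv j (fun x => f x t i) x| ≤ K) ∧
    (∀ i j k, |partialDeriv k (partialDeriv j (fun x => f x t i)) x| ≤ K)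

/-- `y` solves `dy/dt = f(y, t)` on `[s,T]` with `y(s) = x`, in the sense of absolutely continuous
(Carathéodory) solutions; `f` is only measurable in `t`. -/
def IsTrajectory {n : ℕ} (f : EuclideanSpace ℝ (Fin n) → ℝ → EuclideanSpace ℝ (Fin n))
    (s T : ℝ) (x : EuclideanSpace ℝ (Fin n)) (y : ℝ → EuclideanSpace ℝ (Fin n)) : Prop :=
  ContinuousOn y (Set.Icc s T) ∧
  IntervalIntegrable (fun r => f (y r) r) volume s T ∧
  ∀ t ∈ Set.Icc s T, y t = x + ∫ r in s..t, f (y r) r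

/-- `g` is the weak partial derivative `∂u/∂xᵢ` on `ℝⁿ`. -/
def HasWeakPartialDeriv {n : ℕ} (i : Fin n) (u g : EuclideanSpace ℝ (Fin n) → ℝ) : Prop :=
  ∀ η : EuclideanSpace ℝ (Fin n) → ℝ, ContDiff ℝ ∞ η → HasCompactSupport η →
    ∫ x, u x * partialDeriv i η x = -∫ x, g x * η x

/-- `u ∈ H¹ = W₂¹(ℝⁿ)`, for `u ∈ L₂(ℝⁿ)`. -/
def MemH1 {n : ℕ} (u : H0 n) : Prop :=
  ∃ g : Fin n → H0 n, ∀ i, HasWeakPartialDeriv i u (g i)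

/-- `p ∈ X¹[s,T] = L²([s,T] → H¹)`: `p` and its weak gradient are square integrable as functions
of `t` with values in `L₂(ℝⁿ)`. -/
def MemX1 {n : ℕ} (s T : ℝ) (p : ℝ → H0 n) : Prop :=
  MemLp p 2 (volume.restrict (Set.Icc s T)) ∧
  ∃ g : Fin n → ℝ → H0 n, ∀ i,
    MemLp (g i) 2 (volume.restrict (Set.Icc s T)) ∧
    ∀ᵐ t ∂(volume.restrict (Set.Icc s T)), HasWeakPartialDeriv i (p t) (g i t)

/-- `w = A*(·, t) v = - ∑ᵢ ∂/∂xᵢ (fᵢ(·, t) v)` in `L₂(ℝⁿ)`, with weak derivatives. -/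
def IsAdjointApply {n : ℕ} (f : EuclideanSpace ℝ (Fin n) → ℝ → EuclideanSpace ℝ (Fin n))
    (t : ℝ) (v w : H0 n) : Prop :=
  ∃ g : Fin n → H0 n,
    (∀ i, HasWeakPartialDeriv i (fun x => f x t i * v x) (g i)) ∧ w = -∑ i, g i

/-- `p ∈ X¹[s,T] ∩ C([s,T] → L₂)` solves the Cauchy problem `∂p/∂t = A*(·, t) p`, `p(·, s) = ρ₀`:
the time derivative `q = ∂p/∂t` is in `L²([s,T] → L₂)`, and `q(t) = A*(·, t) p(t)` for almost
all `t`. -/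
def IsForwardSolution {n : ℕ}
    (f : EuclideanSpace ℝ (Fin n) → ℝ → EuclideanSpace ℝ (Fin n))
    {s T : ℝ} (hsT : s ≤ T) (ρ₀ : H0 n) (p : C(Set.Icc s T, H0 n)) : Prop :=
  MemX1 s T (Set.IccExtend hsT p) ∧
  ∃ q : ℝ → H0 n,
    MemLp q 2 (volume.restrict (Set.Icc s T)) ∧
    (∀ᵐ t ∂(volume.restrict (Set.Icc s T)),
      IsAdjointApply f t (Set.IccExtend hsT p t) (q t)) ∧
    ∀ t : Set.Icc s T, p t = ρ₀ + ∫ r in s..(t : ℝ), q r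

/-- `Λ` is the operator `𝓛ₛ* : L₂ → C([s,T] → L₂)`: a continuous linear operator on all of
`L₂(ℝⁿ)` which maps each `ρ₀ ∈ H¹` to the one and only solution of the Cauchy problem. -/
def IsForwardOperator {n : ℕ}
    (f : EuclideanSpace ℝ (Fin n) → ℝ → EuclideanSpace ℝ (Fin n))
    {s T : ℝ} (hsT : s ≤ T) (Λ : H0 n →L[ℝ] C(Set.Icc s T, H0 n)) : Prop :=
  ∀ ρ₀ : H0 n, MemH1 ρ₀ → ∀ p : C(Set.Icc s T, H0 n),
    IsForwardSolution f hsT ρ₀ p ↔ p = Λ ρ₀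

/-- `X` is a random vector on `(Ω, P)` with probability density `ρ`. -/
def HasDensity {n : ℕ} {Ω : Type*} [MeasurableSpace Ω] (P : Measure Ω)
    (X : Ω → EuclideanSpace ℝ (Fin n)) (ρ : EuclideanSpace ℝ (Fin n) → ℝ) : Prop :=
  Measurable X ∧ (∀ᵐ x, 0 ≤ ρ x) ∧
  P.map X = volume.withDensity (fun x => ENNReal.ofReal (ρ x))

end

noncomputable section

open Set Filter Topology
open scoped NNReal ENNReal

/-! The proof is the method of characteristics, carried out with Lipschitz bounds in place of a
differentiable flow.

The bounds on `f` and its `x`-derivatives up to order two make `f` bounded, Lipschitz in `x`, and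
controlled in its second differences. Discarding a null set of times makes it jointly Borel
measurable as well, and integral equations do not see the change
(`IsRegularField.exists_isTameField`). Such a field has a global flow, and Grönwall's inequality
passes the Lipschitz and second-difference bounds on to the flow maps.

Each flow map has a Lipschitz inverse, so it inflates preimages of sets by at most a constant
factor, and composition with it is bounded on `L₂`. The adjoint `transferFlow` of this composition
pushes densities forward; it defines the operator of the theorem, and statement 3 holds for every
density in `L₂` without approximation. Following a test function along trajectories and applying
Fubini gives the weak form of the forward equation (`inner_transferFlow_eq_add`). For data in `H¹`
the transported density is a true solution because transfer preserves `H¹`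
(`exists_hasWeakPartialDeriv_transfer`). The second differences are needed here: the first
derivatives of the inverse flow agree almost everywhere with bounded Lipschitz functions, which are
admissible multipliers in an integration by parts.

Uniqueness of solutions is an energy estimate: integration by parts gives `2 (A* v, v) = -∑ ∫ (∂ᵢ
fᵢ) v² ≤ n L ‖v‖²`, and Grönwall applies to the squared norm of the difference of two solutions
(`norm_sq_eq_integral_inner`, `forwardSolution_unique`). The operator is unique because `H¹` is
dense in `L₂`. -/

/-! ### Grönwall inequalities in integral form. -/

/-- The right-hand side `ψ` of the hypothesis satisfies `ψ' ≤ L ψ`, so `ψ(t) exp(-L (t - a))`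
decreases from its initial value `C`. -/
theorem le_mul_exp_of_le_add_integral {φ : ℝ → ℝ} {a b C L : ℝ} (hL : 0 ≤ L)
    (hφ : ContinuousOn φ (Icc a b))
    (h : ∀ t ∈ Icc a b, φ t ≤ C + L * ∫ r in a..t, φ r) :
    ∀ t ∈ Icc a b, φ t ≤ C * Real.exp (L * (t - a)) := by
  intro t ht
  have hab : a ≤ b := ht.1.trans ht.2
  -- The constant extension beyond the endpoints is continuous on the line, so its primitive is
  -- differentiable everywhere.
  set φ' : ℝ → ℝ := IccExtend hab (fun x : Icc a b => φ x) with hφ'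
  have hc : Continuous φ' := (continuousOn_iff_continuous_domRestrict.1 hφ).Icc_extend'
  have heq : ∀ r ∈ Icc a b, φ' r = φ r := fun r hr => IccExtend_of_mem hab _ hr
  set ψ : ℝ → ℝ := fun t => C + L * ∫ r in a..t, φ' r with hψ
  have hψd : ∀ t, HasDerivAt ψ (L * φ' t) t := fun t => by
    have := (hc.integral_hasStrictDerivAt a t).hasDerivAt
    exact (this.const_mul L).const_add C
  have hle : ∀ r ∈ Icc a b, φ' r ≤ ψ r := fun r hr => by
    rw [heq r hr]
    refine (h r hr).trans_eq ?_
    simp only [hψ]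
    congr 2
    apply intervalIntegral.integral_congr
    intro u hu
    rw [uIcc_of_le hr.1] at hu
    exact (heq u ⟨hu.1, hu.2.trans hr.2⟩).symm
  have hgd : ∀ t, HasDerivAt (fun t => ψ t * Real.exp (-(L * (t - a))))
      (L * φ' t * Real.exp (-(L * (t - a))) + ψ t * (Real.exp (-(L * (t - a))) * (-(L * 1)))) t :=
    fun t => (hψd t).mul (((hasDerivAt_id t).sub_const a).const_mul L).neg.exp
  have hanti : AntitoneOn (fun t => ψ t * Real.exp (-(L * (t - a)))) (Icc a b) := by
    apply antitoneOn_of_deriv_nonpos (convex_Icc a b)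
    · exact fun x _ => (hgd x).continuousAt.continuousWithinAt
    · exact fun x _ => (hgd x).differentiableAt.differentiableWithinAt
    · intro x hx
      rw [interior_Icc] at hx
      rw [(hgd x).deriv]
      have h1 := hle x ⟨hx.1.le, hx.2.le⟩
      have h2 := Real.exp_pos (-(L * (x - a)))
      have h3 : L * φ' x ≤ L * ψ x := mul_le_mul_of_nonneg_left h1 hL
      nlinarith [mul_le_mul_of_nonneg_right h3 h2.le]
  have := hanti (left_mem_Icc.2 hab) ht ht.1
  have hψa : ψ a = C := by simp [hψ]
  simp only [sub_self, mul_zero, neg_zero, Real.exp_zero, mul_one, hψa, Real.exp_neg] at this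
  rw [← div_eq_mul_inv, div_le_iff₀ (Real.exp_pos _)] at this
  rw [← heq t ht]
  exact (hle t ht).trans this

/-- Flows are needed in both time directions, since the inverse of a flow map runs backwards; times
before `t₀` are handled by reflection. -/
theorem le_mul_exp_abs_of_le_add_abs_integral {φ : ℝ → ℝ} {t₀ t C L : ℝ} (hL : 0 ≤ L)
    (hφ : Continuous φ) (hpos : ∀ t, 0 ≤ φ t)
    (h : ∀ r ∈ uIcc t₀ t, φ r ≤ C + L * |∫ r in t₀..r, φ r|) :
    φ t ≤ C * Real.exp (L * |t - t₀|) := by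
  rcases le_total t₀ t with ht | ht
  · rw [abs_of_nonneg (sub_nonneg.2 ht)]
    refine le_mul_exp_of_le_add_integral (b := t) hL hφ.continuousOn ?_ t ⟨ht, le_rfl⟩
    intro r hr
    have := h r (by rwa [uIcc_of_le ht])
    rwa [abs_of_nonneg (intervalIntegral.integral_nonneg hr.1 fun u _ => hpos u)] at this
  · rw [abs_of_nonpos (sub_nonpos.2 ht)]
    have key := le_mul_exp_of_le_add_integral (φ := fun r => φ (-r)) (a := -t₀) (b := -t) (C := C) hL
      (hφ.comp continuous_neg).continuousOn ?_ (-t) ⟨by linarith, le_rfl⟩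
    · simpa [sub_eq_add_neg, add_comm] using key
    · intro r hr
      have := h (-r) (by rw [uIcc_of_ge ht]; constructor <;> linarith [hr.1, hr.2])
      refine this.trans_eq ?_
      rw [intervalIntegral.integral_comp_neg, neg_neg, intervalIntegral.integral_symm, abs_neg,
        abs_of_nonneg (intervalIntegral.integral_nonneg (by linarith [hr.1]) fun u _ => hpos u)]

/-! ### Tame vector fields and global existence of integral curves. -/

/-- Bounded time-dependent vector fields, jointly measurable, Lipschitz in space, and with
controlled second differences in space. -/
structure IsTameField {n : ℕ} (F : ℝ → EuclideanSpace ℝ (Fin n) → EuclideanSpace ℝ (Fin n))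
    (M L L₂ : ℝ) : Prop where
  L_nonneg : 0 ≤ L
  L₂_nonneg : 0 ≤ L₂
  bound : ∀ t x, ‖F t x‖ ≤ M
  lip : ∀ t x y, ‖F t x - F t y‖ ≤ L * ‖x - y‖
  second : ∀ t x y v, ‖(F t (x + v) - F t x) - (F t (y + v) - F t y)‖ ≤ L₂ * ‖v‖ * ‖x - y‖
  meas : Measurable fun z : ℝ × EuclideanSpace ℝ (Fin n) => F z.1 z.2

namespace IsTameField

variable {n : ℕ} {F : ℝ → EuclideanSpace ℝ (Fin n) → EuclideanSpace ℝ (Fin n)} {M L L₂ : ℝ}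

theorem M_nonneg (hF : IsTameField F M L L₂) : 0 ≤ M := (norm_nonneg _).trans (hF.bound 0 0)

theorem intervalIntegrable (hF : IsTameField F M L L₂)
    {y : ℝ → EuclideanSpace ℝ (Fin n)} (hy : Measurable y) (a b : ℝ) :
    IntervalIntegrable (fun r => F r (y r)) volume a b := by
  rw [intervalIntegrable_iff]
  have : IsFiniteMeasure (volume.restrict (uIoc a b)) := by
    constructor; simp [uIoc]
  refine Integrable.of_bound (C := M) ?_ (Eventually.of_forall fun r => hF.bound _ _)
  exact (hF.meas.comp (measurable_id.prodMk hy)).aestronglyMeasurable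

theorem norm_integral_le (hF : IsTameField F M L L₂)
    (y : ℝ → EuclideanSpace ℝ (Fin n)) (a b : ℝ) :
    ‖∫ r in a..b, F r (y r)‖ ≤ M * |b - a| :=
  intervalIntegral.norm_integral_le_of_norm_le_const fun _ _ => hF.bound _ _

theorem continuous_integral (hF : IsTameField F M L L₂)
    {y : ℝ → EuclideanSpace ℝ (Fin n)} (hy : Measurable y) (a : ℝ) :
    Continuous fun t => ∫ r in a..t, F r (y r) :=
  intervalIntegral.continuous_primitive (fun _ _ => hF.intervalIntegrable hy _ _) a

end IsTameField

/-- The factor `c⁻¹` is what makes the Picard map a contraction in a norm weighted by this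
exponential. -/
theorem abs_integral_exp_abs_le {t₀ t c : ℝ} (hc : 0 < c) :
    |∫ r in t₀..t, Real.exp (c * |r - t₀|)| ≤ c⁻¹ * Real.exp (c * |t - t₀|) := by
  have hcont : Continuous fun r => Real.exp (c * |r - t₀|) := by fun_prop
  have key : ∀ u, 0 ≤ u → ∫ r in (0:ℝ)..u, Real.exp (c * |r|) ≤ c⁻¹ * Real.exp (c * u) := by
    intro u hu
    have : ∫ r in (0:ℝ)..u, Real.exp (c * |r|) = ∫ r in (0:ℝ)..u, Real.exp (c * r) := by
      apply intervalIntegral.integral_congr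
      intro r hr
      rw [uIcc_of_le hu] at hr
      simp [abs_of_nonneg hr.1]
    rw [this, intervalIntegral.integral_comp_mul_left _ hc.ne', integral_exp]
    simp only [mul_zero, Real.exp_zero, smul_eq_mul]
    have : 0 < c⁻¹ := by positivity
    nlinarith
  rw [intervalIntegral.integral_comp_sub_right (fun r => Real.exp (c * |r|)) t₀, sub_self]
  rcases le_total t₀ t with ht | ht
  · have h0 : 0 ≤ t - t₀ := sub_nonneg.2 ht
    rw [abs_of_nonneg (intervalIntegral.integral_nonneg h0 fun _ _ => (Real.exp_pos _).le),
      abs_of_nonneg h0]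
    exact key _ h0
  · have h0 : 0 ≤ -(t - t₀) := by linarith
    have e : ∫ r in (0:ℝ)..(t - t₀), Real.exp (c * |r|)
        = -∫ r in (0:ℝ)..(-(t - t₀)), Real.exp (c * |r|) := by
      rw [← intervalIntegral.integral_symm]
      have := intervalIntegral.integral_comp_neg (a := -(t - t₀)) (b := 0)
        (fun r => Real.exp (c * |r|))
      simp only [abs_neg, neg_neg, neg_zero] at this
      rw [this]
    rw [e, abs_neg, abs_of_nonneg (intervalIntegral.integral_nonneg h0 fun _ _ => (Real.exp_pos _).le),
      abs_of_nonpos (by linarith : t - t₀ ≤ 0)]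
    exact key _ h0

namespace IsTameField

variable {n : ℕ} {F : ℝ → EuclideanSpace ℝ (Fin n) → EuclideanSpace ℝ (Fin n)} {M L L₂ : ℝ}

-- Picard iteration for `z = y / w` with `w(t) = exp(c |t - t₀|)`. In this weighted norm the
-- integral operator has Lipschitz constant at most `L / c`, so a single fixed point gives the curve
-- on the whole line, with no gluing of local solutions.
open scoped BoundedContinuousFunction in
theorem exists_integralCurve (hF : IsTameField F M L L₂) (t₀ : ℝ) (x : EuclideanSpace ℝ (Fin n)) :
    ∃ y : ℝ → EuclideanSpace ℝ (Fin n), Continuous y ∧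
      ∀ t, y t = x + ∫ r in t₀..t, F r (y r) := by
  -- `c ≥ 2 L` gives the contraction constant `1/2`; `c ≥ 1` gives `w(t) ≥ 1 + |t - t₀|`, which
  -- absorbs the linear growth of curves and keeps `z` bounded.
  set c : ℝ := 2 * L + 1 with hc
  have hc1 : 1 ≤ c := by linarith [hF.L_nonneg]
  have hc0 : 0 < c := by linarith
  let w : ℝ → ℝ := fun t => Real.exp (c * |t - t₀|)
  have hw : Continuous w := by fun_prop
  have hwpos : ∀ t, 0 < w t := fun t => Real.exp_pos _
  have hmeas : ∀ z : ℝ →ᵇ EuclideanSpace ℝ (Fin n), Measurable fun r => w r • z r :=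
    fun z => (hw.smul z.continuous).measurable
  let P : (ℝ →ᵇ EuclideanSpace ℝ (Fin n)) → (ℝ →ᵇ EuclideanSpace ℝ (Fin n)) := fun z =>
    BoundedContinuousFunction.ofNormedAddCommGroup
      (fun t => (w t)⁻¹ • (x + ∫ r in t₀..t, F r (w r • z r)))
      ((hw.inv₀ fun t => (hwpos t).ne').smul
        (continuous_const.add (hF.continuous_integral (hmeas z) t₀)))
      (‖x‖ + M) (by
        intro t
        rw [norm_smul, norm_inv, Real.norm_of_nonneg (hwpos t).le, inv_mul_le_iff₀ (hwpos t)]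
        have h1 := hF.norm_integral_le (fun r => w r • z r) t₀ t
        have h2 : |t - t₀| + 1 ≤ w t := by
          refine le_trans ?_ (Real.add_one_le_exp _)
          nlinarith [abs_nonneg (t - t₀)]
        have h3 := norm_add_le x (∫ r in t₀..t, F r (w r • z r))
        nlinarith [norm_nonneg x, hF.M_nonneg, abs_nonneg (t - t₀)])
  have hP : ContractingWith (1/2) P := by
    refine ⟨by norm_num, LipschitzWith.of_dist_le_mul fun z z' => ?_⟩
    rw [BoundedContinuousFunction.dist_le (by positivity)]
    intro t
    have e : P z t - P z' t
        = (w t)⁻¹ • ∫ r in t₀..t, (F r (w r • z r) - F r (w r • z' r)) := by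
      rw [intervalIntegral.integral_sub (hF.intervalIntegrable (hmeas z) _ _)
        (hF.intervalIntegrable (hmeas z') _ _)]
      change (w t)⁻¹ • (x + ∫ r in t₀..t, F r (w r • z r))
        - (w t)⁻¹ • (x + ∫ r in t₀..t, F r (w r • z' r)) = _
      rw [← smul_sub, add_sub_add_left_eq_sub]
    rw [dist_eq_norm, e, norm_smul, norm_inv, Real.norm_of_nonneg (hwpos t).le,
      inv_mul_le_iff₀ (hwpos t)]
    have h1 : ‖∫ r in t₀..t, (F r (w r • z r) - F r (w r • z' r))‖
        ≤ |∫ r in t₀..t, (L * dist z z') * w r| := by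
      apply intervalIntegral.norm_integral_le_abs_of_norm_le
      · refine Eventually.of_forall fun r => ?_
        refine (hF.lip _ _ _).trans ?_
        rw [← smul_sub, norm_smul, Real.norm_of_nonneg (hwpos r).le, mul_assoc]
        have h2 := BoundedContinuousFunction.dist_coe_le_dist (f := z) (g := z') r
        rw [dist_eq_norm] at h2
        have := mul_le_mul_of_nonneg_left h2 (hwpos r).le
        nlinarith [mul_le_mul_of_nonneg_left this hF.L_nonneg]
      · exact (continuous_const.mul hw).intervalIntegrable _ _
    refine h1.trans ?_
    rw [intervalIntegral.integral_const_mul, abs_mul,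
      abs_of_nonneg (mul_nonneg hF.L_nonneg dist_nonneg)]
    have h3 := abs_integral_exp_abs_le (t₀ := t₀) (t := t) hc0
    have h4 : L * c⁻¹ ≤ 1 / 2 := by
      rw [← div_eq_mul_inv, div_le_iff₀ hc0]; linarith
    calc L * dist z z' * |∫ r in t₀..t, w r| ≤ L * dist z z' * (c⁻¹ * w t) :=
          mul_le_mul_of_nonneg_left h3 (mul_nonneg hF.L_nonneg dist_nonneg)
      _ = (L * c⁻¹) * (dist z z' * w t) := by ring
      _ ≤ (1/2) * (dist z z' * w t) :=
          mul_le_mul_of_nonneg_right h4 (mul_nonneg dist_nonneg (hwpos t).le)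
      _ = w t * (((1/2 : NNReal) : ℝ) * dist z z') := by push_cast; ring
  have hfix := hP.fixedPoint_isFixedPt
  set z := hP.fixedPoint P
  refine ⟨fun t => w t • z t, hw.smul z.continuous, fun t => ?_⟩
  have : z t = (w t)⁻¹ • (x + ∫ r in t₀..t, F r (w r • z r)) := by
    conv_lhs => rw [← hfix.eq]
    rfl
  change w t • z t = _
  rw [this, smul_inv_smul₀ (hwpos t).ne']

/-! ### The flow, its group law, and its first and second differences in space. -/

/-- The flow of a tame field: `hF.flow t₀ t x` is the position at time `t` of the integral curve
which passes through `x` at time `t₀`. -/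
def flow (hF : IsTameField F M L L₂) (t₀ t : ℝ) (x : EuclideanSpace ℝ (Fin n)) :
    EuclideanSpace ℝ (Fin n) :=
  (hF.exists_integralCurve t₀ x).choose t

theorem continuous_flow_time (hF : IsTameField F M L L₂) (t₀ : ℝ) (x : EuclideanSpace ℝ (Fin n)) :
    Continuous fun t => hF.flow t₀ t x :=
  (hF.exists_integralCurve t₀ x).choose_spec.1

theorem flow_eq (hF : IsTameField F M L L₂) (t₀ t : ℝ) (x : EuclideanSpace ℝ (Fin n)) :
    hF.flow t₀ t x = x + ∫ r in t₀..t, F r (hF.flow t₀ r x) :=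
  (hF.exists_integralCurve t₀ x).choose_spec.2 t

/-- One estimate serves twice: distinct starting points give the Lipschitz bound for the flow, equal
ones give uniqueness. The equations are required only between `t₀` and `t`, so that curves on a
bounded interval can be compared with the flow. -/
theorem norm_sub_le_of_integralCurves (hF : IsTameField F M L L₂) {t₀ t : ℝ}
    {x x' : EuclideanSpace ℝ (Fin n)}
    {y y' : ℝ → EuclideanSpace ℝ (Fin n)} (hy : Continuous y) (hy' : Continuous y')
    (h : ∀ r ∈ uIcc t₀ t, y r = x + ∫ u in t₀..r, F u (y u))
    (h' : ∀ r ∈ uIcc t₀ t, y' r = x' + ∫ u in t₀..r, F u (y' u)) :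
    ‖y t - y' t‖ ≤ ‖x - x'‖ * Real.exp (L * |t - t₀|) := by
  refine le_mul_exp_abs_of_le_add_abs_integral (φ := fun t => ‖y t - y' t‖) hF.L_nonneg
    (by fun_prop) (fun _ => norm_nonneg _) fun r hr => ?_
  have e : y r - y' r = (x - x') + ∫ u in t₀..r, (F u (y u) - F u (y' u)) := by
    rw [intervalIntegral.integral_sub (hF.intervalIntegrable hy.measurable _ _)
      (hF.intervalIntegrable hy'.measurable _ _), h r hr, h' r hr]
    abel
  simp only [e]
  refine (norm_add_le _ _).trans (add_le_add_right ?_ _)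
  have e' : L * |∫ u in t₀..r, ‖y u - y' u‖| = |∫ u in t₀..r, L * ‖y u - y' u‖| := by
    rw [intervalIntegral.integral_const_mul, abs_mul, abs_of_nonneg hF.L_nonneg]
  rw [e']
  apply intervalIntegral.norm_integral_le_abs_of_norm_le
  · exact Eventually.of_forall fun u => hF.lip _ _ _
  · exact (by fun_prop : Continuous fun u => L * ‖y u - y' u‖).intervalIntegrable _ _

theorem norm_flow_sub_le (hF : IsTameField F M L L₂) (t₀ t : ℝ)
    (x x' : EuclideanSpace ℝ (Fin n)) :
    ‖hF.flow t₀ t x - hF.flow t₀ t x'‖ ≤ Real.exp (L * |t - t₀|) * ‖x - x'‖ := by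
  rw [mul_comm]
  exact hF.norm_sub_le_of_integralCurves (hF.continuous_flow_time t₀ x)
    (hF.continuous_flow_time t₀ x') (fun r _ => hF.flow_eq _ _ _) (fun r _ => hF.flow_eq _ _ _)

theorem eq_flow_of_integralCurve (hF : IsTameField F M L L₂) {t₀ t : ℝ}
    {x : EuclideanSpace ℝ (Fin n)}
    {y : ℝ → EuclideanSpace ℝ (Fin n)} (hy : Continuous y)
    (h : ∀ r ∈ uIcc t₀ t, y r = x + ∫ u in t₀..r, F u (y u)) : y t = hF.flow t₀ t x := by
  have := hF.norm_sub_le_of_integralCurves hy (hF.continuous_flow_time t₀ x) h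
    (fun r _ => hF.flow_eq _ _ _)
  rw [sub_self, norm_zero, zero_mul] at this
  exact sub_eq_zero.1 (norm_le_zero_iff.1 this)

@[simp]
theorem flow_self (hF : IsTameField F M L L₂) (t₀ : ℝ) (x : EuclideanSpace ℝ (Fin n)) :
    hF.flow t₀ t₀ x = x := by
  rw [hF.flow_eq, intervalIntegral.integral_same, add_zero]

theorem integrable_along_flow (hF : IsTameField F M L L₂) (t₀ : ℝ)
    (x : EuclideanSpace ℝ (Fin n)) (a b : ℝ) :
    IntervalIntegrable (fun r => F r (hF.flow t₀ r x)) volume a b :=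
  hF.intervalIntegrable (hF.continuous_flow_time t₀ x).measurable a b

theorem flow_eq_add (hF : IsTameField F M L L₂) (t₀ t₁ t : ℝ) (x : EuclideanSpace ℝ (Fin n)) :
    hF.flow t₀ t x = hF.flow t₀ t₁ x + ∫ r in t₁..t, F r (hF.flow t₀ r x) := by
  rw [hF.flow_eq t₀ t, hF.flow_eq t₀ t₁, add_assoc,
    intervalIntegral.integral_add_adjacent_intervals (hF.integrable_along_flow _ _ _ _)
      (hF.integrable_along_flow _ _ _ _)]

@[simp]
theorem flow_flow (hF : IsTameField F M L L₂) (t₀ t₁ t : ℝ) (x : EuclideanSpace ℝ (Fin n)) :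
    hF.flow t₁ t (hF.flow t₀ t₁ x) = hF.flow t₀ t x :=
  (hF.eq_flow_of_integralCurve (hF.continuous_flow_time t₀ x)
    fun _ _ => hF.flow_eq_add _ _ _ _).symm

theorem norm_flow_sub_flow_time_le (hF : IsTameField F M L L₂) (t₀ t₁ t : ℝ)
    (x : EuclideanSpace ℝ (Fin n)) :
    ‖hF.flow t₀ t x - hF.flow t₀ t₁ x‖ ≤ M * |t - t₁| := by
  rw [hF.flow_eq_add t₀ t₁ t, add_sub_cancel_left]
  exact hF.norm_integral_le _ _ _

theorem norm_flow_sub_self_le (hF : IsTameField F M L L₂) (t₀ t : ℝ)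
    (x : EuclideanSpace ℝ (Fin n)) : ‖hF.flow t₀ t x - x‖ ≤ M * |t - t₀| := by
  simpa using hF.norm_flow_sub_flow_time_le t₀ t₀ t x

theorem lipschitzWith_flow (hF : IsTameField F M L L₂) (t₀ t : ℝ) :
    LipschitzWith (Real.exp (L * |t - t₀|)).toNNReal (hF.flow t₀ t) :=
  LipschitzWith.of_dist_le_mul fun x y => by
    rw [Real.coe_toNNReal _ (Real.exp_pos _).le, dist_eq_norm, dist_eq_norm]
    exact hF.norm_flow_sub_le _ _ _ _

theorem continuous_flow (hF : IsTameField F M L L₂) (t₀ t : ℝ) : Continuous (hF.flow t₀ t) :=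
  (hF.lipschitzWith_flow t₀ t).continuous

theorem continuous_uncurry_flow (hF : IsTameField F M L L₂) (t₀ : ℝ) :
    Continuous fun z : ℝ × EuclideanSpace ℝ (Fin n) => hF.flow t₀ z.1 z.2 := by
  rw [continuous_iff_continuousAt]
  rintro ⟨t, x⟩
  rw [ContinuousAt, tendsto_iff_norm_sub_tendsto_zero]
  have h : ∀ z : ℝ × EuclideanSpace ℝ (Fin n), ‖hF.flow t₀ z.1 z.2 - hF.flow t₀ t x‖
      ≤ Real.exp (L * |z.1 - t₀|) * ‖z.2 - x‖ + M * |z.1 - t| := fun z => by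
    refine (norm_sub_le_norm_sub_add_norm_sub _ (hF.flow t₀ z.1 x) _).trans
      (add_le_add (hF.norm_flow_sub_le _ _ _ _) (hF.norm_flow_sub_flow_time_le _ _ _ _))
  refine squeeze_zero (fun _ => norm_nonneg _) h ?_
  have hc : Continuous fun z : ℝ × EuclideanSpace ℝ (Fin n) =>
      Real.exp (L * |z.1 - t₀|) * ‖z.2 - x‖ + M * |z.1 - t| := by fun_prop
  simpa using hc.tendsto (t, x)

/-- Compare `a` with `b + (c - d)`, the point completing the parallelogram: the Lipschitz bound
measures the gap between them, and the second-difference bound applies to the exact parallelogram.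
-/
theorem norm_second_difference_le (hF : IsTameField F M L L₂) (t : ℝ)
    (a b c d : EuclideanSpace ℝ (Fin n)) :
    ‖F t a - F t b - (F t c - F t d)‖ ≤ L * ‖a - b - (c - d)‖ + L₂ * ‖c - d‖ * ‖b - d‖ := by
  have h1 := hF.lip t a (b + (c - d))
  have h2 := hF.second t b d (c - d)
  rw [add_sub_cancel] at h2
  calc _ = ‖(F t a - F t (b + (c - d))) + (F t (b + (c - d)) - F t b - (F t c - F t d))‖ := by
        congr 1; abel
    _ ≤ _ := (norm_add_le _ _).trans (add_le_add (h1.trans_eq (by rw [sub_add_eq_sub_sub])) h2)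

/-- This replaces a bound on second derivatives of the flow. The second difference of four
trajectories solves a linear integral inequality whose source is the product of two first
differences, and Grönwall closes it. -/
theorem norm_flow_second_difference_le (hF : IsTameField F M L L₂) (t₀ t : ℝ)
    (x y v : EuclideanSpace ℝ (Fin n)) :
    ‖hF.flow t₀ t (x + v) - hF.flow t₀ t x - (hF.flow t₀ t (y + v) - hF.flow t₀ t y)‖
      ≤ (L₂ * |t - t₀| * Real.exp (3 * (L * |t - t₀|))) * ‖v‖ * ‖x - y‖ := by
  -- `C` bounds the source; each of its two first differences costs one factor `exp(L |t - t₀|)`.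
  -- Grönwall adds the third.
  set C := L₂ * Real.exp (2 * (L * |t - t₀|)) * ‖v‖ * ‖x - y‖ with hC
  have hC0 : 0 ≤ C := by have := hF.L₂_nonneg; positivity
  have hL := hF.L_nonneg
  set D : ℝ → EuclideanSpace ℝ (Fin n) := fun r =>
    hF.flow t₀ r (x + v) - hF.flow t₀ r x - (hF.flow t₀ r (y + v) - hF.flow t₀ r y) with hD
  have hcf := hF.continuous_flow_time t₀
  have hDc : Continuous D := ((hcf _).sub (hcf _)).sub ((hcf _).sub (hcf _))
  have key : ‖D t‖ ≤ (C * |t - t₀|) * Real.exp (L * |t - t₀|) := by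
    refine le_mul_exp_abs_of_le_add_abs_integral (φ := fun r => ‖D r‖) hL hDc.norm
      (fun _ => norm_nonneg _) fun r hr => ?_
    have hi := hF.integrable_along_flow t₀
    have e : D r = ∫ u in t₀..r, (F u (hF.flow t₀ u (x + v)) - F u (hF.flow t₀ u x)
        - (F u (hF.flow t₀ u (y + v)) - F u (hF.flow t₀ u y))) := by
      rw [intervalIntegral.integral_sub ((hi _ _ _).sub (hi _ _ _)) ((hi _ _ _).sub (hi _ _ _)),
        intervalIntegral.integral_sub (hi _ _ _) (hi _ _ _),
        intervalIntegral.integral_sub (hi _ _ _) (hi _ _ _)]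
      simp only [hD]
      rw [hF.flow_eq t₀ r (x + v), hF.flow_eq t₀ r x, hF.flow_eq t₀ r (y + v), hF.flow_eq t₀ r y]
      abel
    have hrt : |r - t₀| ≤ |t - t₀| := abs_sub_left_of_mem_uIcc hr
    have hci : IntervalIntegrable (fun u => C + L * ‖D u‖) volume t₀ r :=
      (by fun_prop : Continuous fun u => C + L * ‖D u‖).intervalIntegrable _ _
    have h1 : ‖D r‖ ≤ |∫ u in t₀..r, (C + L * ‖D u‖)| := by
      rw [e]
      apply intervalIntegral.norm_integral_le_abs_of_norm_le _ hci
      filter_upwards [ae_restrict_mem measurableSet_uIoc] with u hu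
      have hut : |u - t₀| ≤ |t - t₀| :=
        (abs_sub_left_of_mem_uIcc (uIoc_subset_uIcc hu)).trans hrt
      refine (hF.norm_second_difference_le u _ _ _ _).trans ?_
      rw [add_comm]
      refine add_le_add_left ?_ _
      have hexp : Real.exp (L * |u - t₀|) ≤ Real.exp (L * |t - t₀|) :=
        Real.exp_le_exp.2 (mul_le_mul_of_nonneg_left hut hL)
      have h2 := (hF.norm_flow_sub_le t₀ u (y + v) y).trans
        (mul_le_mul_of_nonneg_right hexp (norm_nonneg _))
      have h3 := (hF.norm_flow_sub_le t₀ u x y).trans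
        (mul_le_mul_of_nonneg_right hexp (norm_nonneg _))
      rw [add_sub_cancel_left] at h2
      calc _ ≤ L₂ * (Real.exp (L * |t - t₀|) * ‖v‖) * (Real.exp (L * |t - t₀|) * ‖x - y‖) := by
            have := hF.L₂_nonneg
            gcongr
        _ = C := by rw [hC, two_mul, Real.exp_add]; ring
    refine h1.trans ?_
    clear_value C
    rw [intervalIntegral.integral_add (by simp)
      ((by fun_prop : Continuous fun u => L * ‖D u‖).intervalIntegrable _ _),
      intervalIntegral.integral_const_mul, intervalIntegral.integral_const]
    refine (abs_add_le _ _).trans (add_le_add ?_ ?_)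
    · rw [smul_eq_mul, abs_mul, abs_of_nonneg hC0, mul_comm]
      exact mul_le_mul_of_nonneg_left hrt hC0
    · rw [abs_mul, abs_of_nonneg hL]
  refine key.trans_eq ?_
  rw [hC, show 3 * (L * |t - t₀|) = 2 * (L * |t - t₀|) + L * |t - t₀| by ring, Real.exp_add]
  ring

end IsTameField

/-! ### Test functions and their density in `L₂`. -/

/-- Smooth compactly supported functions. -/
structure IsTestFunction {n : ℕ} (η : EuclideanSpace ℝ (Fin n) → ℝ) : Prop where
  contDiff : ContDiff ℝ ∞ η
  hasCompactSupport : HasCompactSupport η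

theorem memLp_two_of_bounded_of_compact_support {n : ℕ} {w : EuclideanSpace ℝ (Fin n) → ℝ} {C : ℝ}
    {K : Set (EuclideanSpace ℝ (Fin n))} (hK : IsCompact K)
    (hw : AEStronglyMeasurable w volume) (hC : ∀ x, |w x| ≤ C) (h0 : ∀ x ∉ K, w x = 0) :
    MemLp w 2 := by
  have h1 : MemLp (K.indicator fun _ => C) 2 (volume : Measure (EuclideanSpace ℝ (Fin n))) :=
    memLp_indicator_const _ hK.measurableSet _ (Or.inr hK.measure_lt_top.ne)
  refine h1.mono hw (Eventually.of_forall fun x => ?_)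
  by_cases hx : x ∈ K
  · rw [indicator_of_mem hx]
    exact (hC x).trans (le_abs_self C)
  · simp [h0 x hx]

theorem MeasureTheory.MemLp.bounded_mul {n : ℕ} {u φ : EuclideanSpace ℝ (Fin n) → ℝ} {B : ℝ}
    (hu : MemLp u 2) (hφ : AEStronglyMeasurable φ volume) (hB : ∀ x, |φ x| ≤ B) :
    MemLp (fun x => φ x * u x) 2 :=
  hu.of_le_mul (c := B) (hφ.mul hu.1) (Eventually.of_forall fun x => by
    rw [norm_mul]; exact mul_le_mul_of_nonneg_right (hB x) (norm_nonneg _))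

theorem MeasureTheory.MemLp.integrable_mul_two {n : ℕ} {u v : EuclideanSpace ℝ (Fin n) → ℝ}
    (hu : MemLp u 2) (hv : MemLp v 2) : Integrable fun x => u x * v x :=
  hu.integrable_mul hv

theorem H0.inner_eq {n : ℕ} (u v : H0 n) : inner ℝ u v = ∫ x, u x * v x := by
  rw [L2.inner_def]
  congr 1; ext x
  simp [mul_comm]

theorem H0.inner_toLp_right {n : ℕ} (u : H0 n) {v : EuclideanSpace ℝ (Fin n) → ℝ}
    (hv : MemLp v 2) : inner ℝ u (hv.toLp v) = ∫ x, u x * v x := by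
  rw [H0.inner_eq]
  refine integral_congr_ae ?_
  filter_upwards [hv.coeFn_toLp] with x hx
  rw [hx]

theorem H0.inner_toLp_left {n : ℕ} (u : H0 n) {v : EuclideanSpace ℝ (Fin n) → ℝ}
    (hv : MemLp v 2) : inner ℝ (hv.toLp v) u = ∫ x, v x * u x := by
  rw [H0.inner_eq]
  refine integral_congr_ae ?_
  filter_upwards [hv.coeFn_toLp] with x hx
  rw [hx]

theorem partialDeriv_eq_zero_of_notMem_tsupport {n : ℕ} {η : EuclideanSpace ℝ (Fin n) → ℝ}
    {x : EuclideanSpace ℝ (Fin n)} (hx : x ∉ tsupport η) (i : Fin n) : partialDeriv i η x = 0 := by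
  have h : η =ᶠ[𝓝 x] fun _ => 0 := by
    rwa [notMem_tsupport_iff_eventuallyEq] at hx
  rw [partialDeriv, h.lineDeriv_eq]
  simp [lineDeriv]

namespace IsTestFunction

variable {n : ℕ} {η : EuclideanSpace ℝ (Fin n) → ℝ}

theorem memLp (hη : IsTestFunction η) : MemLp η 2 :=
  hη.contDiff.continuous.memLp_of_hasCompactSupport hη.hasCompactSupport

theorem differentiable (hη : IsTestFunction η) : Differentiable ℝ η :=
  hη.contDiff.differentiable (by simp)

theorem partialDeriv_eq (hη : IsTestFunction η) (i : Fin n) :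
    partialDeriv i η = fun x => fderiv ℝ η x (EuclideanSpace.single i 1) := by
  ext x
  exact (hη.differentiable x).lineDeriv_eq_fderiv

theorem partialDeriv (hη : IsTestFunction η) (i : Fin n) : IsTestFunction (partialDeriv i η) where
  contDiff := by
    rw [hη.partialDeriv_eq]
    exact (hη.contDiff.fderiv_right (m := ∞) (by simp)).clm_apply contDiff_const
  hasCompactSupport := by
    rw [hη.partialDeriv_eq]
    exact (hη.hasCompactSupport.fderiv ℝ).mono' fun x hx => by
      apply subset_tsupport
      simp only [Function.mem_support] at hx ⊢
      contrapose! hx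
      simp [hx]

theorem exists_lipschitzWith (hη : IsTestFunction η) : ∃ C, LipschitzWith C η :=
  hη.contDiff.lipschitzWith_of_hasCompactSupport hη.hasCompactSupport (by simp)

theorem exists_bound (hη : IsTestFunction η) : ∃ C, ∀ x, |η x| ≤ C :=
  hη.hasCompactSupport.exists_bound_of_continuous hη.contDiff.continuous

theorem comp_sub_const (hη : IsTestFunction η) (a : EuclideanSpace ℝ (Fin n)) :
    IsTestFunction fun x => η (x - a) where
  contDiff := hη.contDiff.comp (contDiff_id.sub contDiff_const)
  hasCompactSupport := by
    have := hη.hasCompactSupport.comp_homeomorph (Homeomorph.subRight a)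
    exact this

end IsTestFunction

/-- The space of classes of smooth compactly supported functions in `L₂`. -/
def testSubmodule (n : ℕ) : Submodule ℝ (H0 n) where
  carrier := {u | ∃ η : EuclideanSpace ℝ (Fin n) → ℝ, ∃ h : IsTestFunction η, h.memLp.toLp η = u}
  add_mem' := by
    rintro _ _ ⟨η, h, rfl⟩ ⟨η', h', rfl⟩
    exact ⟨η + η', ⟨h.contDiff.add h'.contDiff, h.hasCompactSupport.add h'.hasCompactSupport⟩, rfl⟩
  zero_mem' := ⟨0, ⟨contDiff_const, HasCompactSupport.zero⟩, rfl⟩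
  smul_mem' := by
    rintro c _ ⟨η, h, rfl⟩
    exact ⟨c • η, ⟨contDiff_const.smul h.contDiff, h.hasCompactSupport.smul_left⟩, rfl⟩

theorem ae_eq_of_forall_test {n : ℕ} {v w : EuclideanSpace ℝ (Fin n) → ℝ}
    (hv : MemLp v 2) (hw : MemLp w 2)
    (h : ∀ η : EuclideanSpace ℝ (Fin n) → ℝ, IsTestFunction η → ∫ x, v x * η x = ∫ x, w x * η x) :
    v =ᵐ[volume] w :=
  ae_eq_of_integral_contDiff_smul_eq (hv.locallyIntegrable (by norm_num))
    (hw.locallyIntegrable (by norm_num)) fun η h1 h2 => by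
      simpa [mul_comm] using h η ⟨h1, h2⟩

theorem H0.ext_test {n : ℕ} {v w : H0 n}
    (h : ∀ η : EuclideanSpace ℝ (Fin n) → ℝ, ∀ hη : IsTestFunction η,
      inner ℝ v (hη.memLp.toLp η) = inner ℝ w (hη.memLp.toLp η)) : v = w :=
  Lp.ext (ae_eq_of_forall_test (Lp.memLp v) (Lp.memLp w) fun η hη => by
    simpa only [H0.inner_toLp_right] using h η hη)

theorem dense_testSubmodule (n : ℕ) : Dense (testSubmodule n : Set (H0 n)) := by
  rw [Submodule.dense_iff_topologicalClosure_eq_top, Submodule.topologicalClosure_eq_top_iff,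
    Submodule.eq_bot_iff]
  intro u hu
  apply H0.ext_test
  intro η hη
  rw [inner_zero_left, real_inner_comm]
  exact (Submodule.mem_orthogonal _ _).1 hu _ ⟨η, hη, rfl⟩

/-! ### Weak partial derivatives. -/

namespace HasWeakPartialDeriv

variable {n : ℕ} {i : Fin n} {u v g h : EuclideanSpace ℝ (Fin n) → ℝ}

theorem eq_neg (hu : HasWeakPartialDeriv i u g) {η : EuclideanSpace ℝ (Fin n) → ℝ}
    (hη : IsTestFunction η) : ∫ x, u x * partialDeriv i η x = -∫ x, g x * η x :=
  hu η hη.contDiff hη.hasCompactSupport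

theorem of_test (h : ∀ η : EuclideanSpace ℝ (Fin n) → ℝ, IsTestFunction η →
    ∫ x, u x * partialDeriv i η x = -∫ x, g x * η x) : HasWeakPartialDeriv i u g :=
  fun η h1 h2 => h η ⟨h1, h2⟩

theorem congr (hu : HasWeakPartialDeriv i u g) (huv : u =ᵐ[volume] v) (hgh : g =ᵐ[volume] h) :
    HasWeakPartialDeriv i v h := of_test fun η hη => by
  have h1 : ∫ x, v x * partialDeriv i η x = ∫ x, u x * partialDeriv i η x :=
    integral_congr_ae (by filter_upwards [huv] with x hx; rw [hx])
  have h2 : ∫ x, h x * η x = ∫ x, g x * η x :=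
    integral_congr_ae (by filter_upwards [hgh] with x hx; rw [hx])
  rw [h1, h2, hu.eq_neg hη]

theorem ae_unique (hg : MemLp g 2) (hh : MemLp h 2) (h1 : HasWeakPartialDeriv i u g)
    (h2 : HasWeakPartialDeriv i u h) : g =ᵐ[volume] h :=
  ae_eq_of_forall_test hg hh fun η hη => by
    have := (h1.eq_neg hη).symm.trans (h2.eq_neg hη)
    exact neg_injective this

theorem sub (hu2 : MemLp u 2) (hv2 : MemLp v 2) (hg2 : MemLp g 2) (hh2 : MemLp h 2)
    (hu : HasWeakPartialDeriv i u g) (hv : HasWeakPartialDeriv i v h) :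
    HasWeakPartialDeriv i (u - v) (g - h) := of_test fun η hη => by
  have hd := (hη.partialDeriv i).memLp
  simp only [Pi.sub_apply, sub_mul]
  rw [integral_sub (hu2.integrable_mul_two hd) (hv2.integrable_mul_two hd),
    integral_sub (hg2.integrable_mul_two hη.memLp) (hh2.integrable_mul_two hη.memLp),
    hu.eq_neg hη, hv.eq_neg hη]
  ring

end HasWeakPartialDeriv

/-! ### Translations in `L₂` and integration by parts. -/

/-- Translation by `h` along the `i`-th coordinate axis, as an isometry of `L₂`. -/
def translation {n : ℕ} (i : Fin n) (h : ℝ) : H0 n →ₗᵢ[ℝ] H0 n :=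
  Lp.compMeasurePreservingₗᵢ ℝ (fun x => x + h • EuclideanSpace.single i 1)
    (measurePreserving_add_right volume _)

section Translation

variable {n : ℕ} (i : Fin n)

theorem coeFn_translation (h : ℝ) (u : H0 n) :
    translation i h u =ᵐ[volume] fun x => u (x + h • EuclideanSpace.single i 1) :=
  Lp.coeFn_compMeasurePreserving _ (measurePreserving_add_right volume _)

theorem translation_translation (h k : ℝ) (u : H0 n) :
    translation i h (translation i k u) = translation i (h + k) u := by
  apply Lp.ext
  have h1 := (measurePreserving_add_right (volume : Measure (EuclideanSpace ℝ (Fin n)))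
    (h • EuclideanSpace.single i (1:ℝ))).quasiMeasurePreserving.ae_eq_comp
    (coeFn_translation i k u)
  filter_upwards [coeFn_translation i h (translation i k u), h1, coeFn_translation i (h + k) u]
    with x h2 h3 h4
  simp only [Function.comp] at h3
  rw [h2, h3, h4, add_assoc, ← add_smul]

@[simp]
theorem translation_zero (u : H0 n) : translation i 0 u = u := by
  apply Lp.ext
  filter_upwards [coeFn_translation i 0 u] with x hx
  simp [hx]

theorem inner_translation_left (h : ℝ) (u v : H0 n) :
    inner ℝ (translation i h u) v = inner ℝ u (translation i (-h) v) := by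
  rw [← (translation i (-h)).inner_map_map, translation_translation]
  simp

theorem continuous_translation (u : H0 n) : Continuous fun h => translation i h u := by
  let g : C(ℝ, C(EuclideanSpace ℝ (Fin n), EuclideanSpace ℝ (Fin n))) :=
    (ContinuousMap.mk (fun a : ℝ × EuclideanSpace ℝ (Fin n) =>
      a.2 + a.1 • EuclideanSpace.single i (1:ℝ)) (by fun_prop)).curry
  exact (continuous_const (y := u)).compMeasurePreservingLp g.continuous
    (fun h => measurePreserving_add_right volume (h • EuclideanSpace.single i (1:ℝ)))
    (by norm_num)

theorem inner_translation_toLp (h : ℝ) (u : H0 n) {η : EuclideanSpace ℝ (Fin n) → ℝ}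
    (hη : IsTestFunction η) :
    inner ℝ (translation i h u) (hη.memLp.toLp η)
      = ∫ x, u x * η (x - h • EuclideanSpace.single i 1) := by
  rw [inner_translation_left, H0.inner_eq]
  refine integral_congr_ae ?_
  have h1 := (measurePreserving_add_right (volume : Measure (EuclideanSpace ℝ (Fin n)))
    ((-h) • EuclideanSpace.single i (1:ℝ))).quasiMeasurePreserving.ae_eq_comp
    hη.memLp.coeFn_toLp
  filter_upwards [coeFn_translation i (-h) (hη.memLp.toLp η), h1] with x h2 h3
  simp only [Function.comp] at h3
  rw [h2, h3, neg_smul, sub_eq_add_neg]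

theorem hasDerivAt_integral_mul_translate {u : EuclideanSpace ℝ (Fin n) → ℝ} (hu : MemLp u 2)
    {η : EuclideanSpace ℝ (Fin n) → ℝ} (hη : IsTestFunction η) :
    HasDerivAt (fun h : ℝ => ∫ x, u x * η (x - h • EuclideanSpace.single i 1))
      (-∫ x, u x * partialDeriv i η x) 0 := by
  set e : EuclideanSpace ℝ (Fin n) := EuclideanSpace.single i 1 with he
  have hen : ‖e‖ = 1 := by simp [he]
  have hd := hη.partialDeriv i
  obtain ⟨C, hC⟩ := hd.exists_bound
  -- `K` contains the supports of all translates of `η` by `|h| < 1`, so one indicator dominates the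
  -- whole family.
  set K := Metric.cthickening 1 (tsupport η) with hK
  have hKc : IsCompact K := IsCompact.cthickening hη.hasCompactSupport
  have hb : MemLp (K.indicator fun _ => C) 2 (volume : Measure (EuclideanSpace ℝ (Fin n))) :=
    memLp_indicator_const _ hKc.measurableSet _ (Or.inr hKc.measure_lt_top.ne)
  have key := hasDerivAt_integral_of_dominated_loc_of_deriv_le (μ := volume)
    (F := fun (h : ℝ) x => u x * η (x - h • e))
    (F' := fun (h : ℝ) x => u x * -(partialDeriv i η (x - h • e))) (x₀ := (0 : ℝ))
    (bound := fun x => ‖u x‖ * K.indicator (fun _ => C) x)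
    (s := Metric.ball 0 1) (Metric.ball_mem_nhds _ one_pos) ?_ ?_ ?_ ?_ ?_ ?_
  · have := key.2
    simpa [integral_neg] using this
  · exact Eventually.of_forall fun h => hu.1.mul (hη.comp_sub_const _).memLp.1
  · exact hu.integrable_mul_two (hη.comp_sub_const _).memLp
  · exact hu.1.mul (hd.comp_sub_const _).memLp.1.neg
  · refine Eventually.of_forall fun x h hh => ?_
    rw [norm_mul, norm_neg]
    refine mul_le_mul_of_nonneg_left ?_ (norm_nonneg _)
    by_cases hx : x ∈ K
    · rw [indicator_of_mem hx]; exact hC _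
    · rw [indicator_of_notMem hx, partialDeriv_eq_zero_of_notMem_tsupport, norm_zero]
      contrapose! hx
      refine Metric.mem_cthickening_of_dist_le x _ _ _ hx ?_
      rw [dist_eq_norm, sub_sub_cancel, norm_smul, hen, mul_one]
      simpa using (mem_ball_zero_iff.1 hh).le
  · exact hu.norm.integrable_mul_two hb
  · refine Eventually.of_forall fun x h _ => ?_
    refine HasDerivAt.const_mul _ ?_
    have h1 : HasDerivAt (fun h : ℝ => x - h • e) (-e) h := by
      simpa using ((hasDerivAt_id h).smul_const e).const_sub x
    have h2 := (hη.differentiable (x - h • e)).hasFDerivAt.comp_hasDerivAt h h1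
    rw [map_neg] at h2
    rw [hη.partialDeriv_eq]
    exact h2

/-- Paired with any test function, the two sides have the same derivative in `h`. A weak derivative
is thereby recognised as the derivative of the translation group in the norm of `L₂`. -/
theorem HasWeakPartialDeriv.translation_eq {u g : H0 n} {i : Fin n} (hu : HasWeakPartialDeriv i u g)
    (h : ℝ) : translation i h u = u + ∫ r in (0:ℝ)..h, translation i r g := by
  apply H0.ext_test
  intro η hη
  have hd : ∀ r : ℝ, HasDerivAt (fun r => inner ℝ (translation i r u) (hη.memLp.toLp η))
      (inner ℝ (translation i r g) (hη.memLp.toLp η)) r := by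
    intro r
    have hη' := hη.comp_sub_const (r • EuclideanSpace.single i 1)
    have h1 := hasDerivAt_integral_mul_translate i (Lp.memLp u) hη'
    rw [hu.eq_neg hη', neg_neg, ← inner_translation_toLp i r g hη] at h1
    have h2 : HasDerivAt (fun k : ℝ => k - r) 1 r := (hasDerivAt_id r).sub_const r
    have h3 := HasDerivAt.comp (h₂ := fun h : ℝ => ∫ x, u x *
      η (x - h • EuclideanSpace.single i 1 - r • EuclideanSpace.single i 1)) r
      (by simpa using h1) h2
    rw [mul_one] at h3
    refine h3.congr_of_eventuallyEq (Eventually.of_forall fun k => ?_)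
    refine (inner_translation_toLp i k u hη).trans ?_
    simp only [Function.comp, sub_sub, ← add_smul, sub_add_cancel]
  have hc : Continuous fun r => inner ℝ (translation i r g) (hη.memLp.toLp η) :=
    (continuous_translation i g).inner continuous_const
  have h1 := intervalIntegral.integral_eq_sub_of_hasDerivAt (a := 0) (b := h) (fun r _ => hd r)
    (hc.intervalIntegrable _ _)
  have h2 : inner ℝ (∫ r in (0:ℝ)..h, translation i r g) (hη.memLp.toLp η)
      = ∫ r in (0:ℝ)..h, inner ℝ (translation i r g) (hη.memLp.toLp η) := by
    have := (innerSL ℝ (hη.memLp.toLp η)).intervalIntegral_comp_comm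
      ((continuous_translation i g).intervalIntegrable (μ := volume) 0 h)
    simpa only [innerSL_apply_apply, real_inner_comm] using this.symm
  rw [inner_add_left, h2, h1]
  simp

theorem HasWeakPartialDeriv.hasDerivAt_translation {u g : H0 n} {i : Fin n}
    (hu : HasWeakPartialDeriv i u g) : HasDerivAt (fun h => translation i h u) g 0 := by
  have h1 := ((continuous_translation i g).integral_hasStrictDerivAt 0 0).hasDerivAt.const_add u
  rw [translation_zero] at h1
  exact h1.congr_of_eventuallyEq (Eventually.of_forall fun h => hu.translation_eq h)

/-- Translations are unitary, so their generator is antisymmetric; no mollification is needed. Both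
sides are derivatives at `0` of the same function of `h`, with the shift placed on either factor. -/
theorem HasWeakPartialDeriv.inner_eq_neg {u gu v gv : H0 n} {i : Fin n}
    (hu : HasWeakPartialDeriv i u gu) (hv : HasWeakPartialDeriv i v gv) :
    inner ℝ u gv = -inner ℝ gu v := by
  have h1 : HasDerivAt (fun h => inner ℝ u (translation i h v)) (inner ℝ u gv) 0 := by
    simpa using (hasDerivAt_const (0:ℝ) u).inner ℝ hv.hasDerivAt_translation
  have h2 : HasDerivAt (fun h : ℝ => inner ℝ (translation i (-h) u) v) (-inner ℝ gu v) 0 := by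
    have h3 : HasDerivAt (fun h : ℝ => translation i (-h) u) (-gu) 0 := by
      have := HasDerivAt.scomp (h := fun h : ℝ => -h) (0:ℝ)
        (g₁ := fun h => translation i h u) (g₁' := gu)
        (by simpa using hu.hasDerivAt_translation) (hasDerivAt_neg 0)
      rw [neg_one_smul] at this
      exact this
    simpa using h3.inner ℝ (hasDerivAt_const (0:ℝ) v)
  refine h1.unique (h2.congr_of_eventuallyEq (Eventually.of_forall fun h => ?_))
  simp only [inner_translation_left, neg_neg]

end Translation

/-- Integration by parts for functions of class `W₂¹`. -/
theorem HasWeakPartialDeriv.integral_mul_eq_neg {n : ℕ} {i : Fin n}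
    {u gu v gv : EuclideanSpace ℝ (Fin n) → ℝ}
    (hu2 : MemLp u 2) (hgu : MemLp gu 2) (hv2 : MemLp v 2) (hgv : MemLp gv 2)
    (hu : HasWeakPartialDeriv i u gu) (hv : HasWeakPartialDeriv i v gv) :
    ∫ x, u x * gv x = -∫ x, gu x * v x := by
  have h1 : HasWeakPartialDeriv i (hu2.toLp u) (hgu.toLp gu) :=
    hu.congr hu2.coeFn_toLp.symm hgu.coeFn_toLp.symm
  have h2 : HasWeakPartialDeriv i (hv2.toLp v) (hgv.toLp gv) :=
    hv.congr hv2.coeFn_toLp.symm hgv.coeFn_toLp.symm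
  have := h1.inner_eq_neg h2
  rw [H0.inner_toLp_right, H0.inner_toLp_right] at this
  convert this using 1
  · refine integral_congr_ae ?_
    filter_upwards [hu2.coeFn_toLp] with x hx
    rw [hx]
  · congr 1
    refine integral_congr_ae ?_
    filter_upwards [hgu.coeFn_toLp] with x hx
    rw [hx]

/-! ### Lipschitz functions as weakly differentiable multipliers. -/

section Lipschitz

variable {n : ℕ} {w φ : EuclideanSpace ℝ (Fin n) → ℝ} {C : NNReal}

theorem abs_partialDeriv_le_of_lipschitz (hw : LipschitzWith C w) (i : Fin n)
    (x : EuclideanSpace ℝ (Fin n)) : |partialDeriv i w x| ≤ C := by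
  have := norm_lineDeriv_le_of_lipschitz ℝ hw (x₀ := x) (v := EuclideanSpace.single i 1)
  simpa [partialDeriv] using this

theorem aestronglyMeasurable_partialDeriv (hw : Continuous w) (i : Fin n) :
    AEStronglyMeasurable (partialDeriv i w) volume :=
  aestronglyMeasurable_lineDeriv hw volume

theorem memLp_partialDeriv_of_lipschitz (hw : LipschitzWith C w) (hs : HasCompactSupport w)
    (i : Fin n) : MemLp (partialDeriv i w) 2 :=
  memLp_two_of_bounded_of_compact_support hs (aestronglyMeasurable_partialDeriv hw.continuous i)
    (abs_partialDeriv_le_of_lipschitz hw i) fun _ hx => partialDeriv_eq_zero_of_notMem_tsupport hx i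

theorem hasWeakPartialDeriv_of_lipschitz (hw : LipschitzWith C w) (i : Fin n) :
    HasWeakPartialDeriv i w (partialDeriv i w) := HasWeakPartialDeriv.of_test fun η hη => by
  obtain ⟨D, hD⟩ := hη.exists_lipschitzWith
  have := hw.integral_lineDeriv_mul_eq (μ := volume) hD hη.hasCompactSupport
    (EuclideanSpace.single i 1)
  simp only [partialDeriv]
  rw [this]
  simp [lineDeriv_neg, integral_neg, mul_comm]

theorem lipschitzWith_mul_of_bounded {w φ : EuclideanSpace ℝ (Fin n) → ℝ} {C D A B : NNReal}
    (hw : LipschitzWith C w) (hφ : LipschitzWith D φ) (hA : ∀ x, |w x| ≤ A) (hB : ∀ x, |φ x| ≤ B) :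
    LipschitzWith (B * C + A * D) fun x => φ x * w x :=
  LipschitzWith.of_dist_le_mul fun x y => by
    have h1 := hw.dist_le_mul x y
    have h2 := hφ.dist_le_mul x y
    rw [Real.dist_eq] at h1 h2 ⊢
    have e : φ x * w x - φ y * w y = φ x * (w x - w y) + w y * (φ x - φ y) := by ring
    rw [e]
    refine (abs_add_le _ _).trans ?_
    rw [abs_mul, abs_mul]
    push_cast
    rw [add_mul, mul_assoc, mul_assoc]
    gcongr
    · exact hB x
    · exact hA y

theorem partialDeriv_mul_ae (hφ : LipschitzWith C φ) {η : EuclideanSpace ℝ (Fin n) → ℝ}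
    (hη : IsTestFunction η) (i : Fin n) :
    partialDeriv i (fun x => φ x * η x) =ᵐ[volume]
      fun x => partialDeriv i φ x * η x + φ x * partialDeriv i η x := by
  filter_upwards [hφ.ae_lineDifferentiableAt (μ := volume) (EuclideanSpace.single i 1)] with x hx
  have h1 := hx.hasLineDerivAt
  have h2 := ((hη.differentiable x).lineDifferentiableAt
    (v := EuclideanSpace.single i 1)).hasLineDerivAt
  have h3 := HasDerivAt.mul h1 h2
  simp only [zero_smul, add_zero] at h3
  exact HasDerivAt.deriv h3

/-- Product rule for a bounded Lipschitz function and a function of class `W₂¹`. -/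
theorem HasWeakPartialDeriv.lipschitz_mul {u g : EuclideanSpace ℝ (Fin n) → ℝ} {i : Fin n} {B : ℝ}
    (hu2 : MemLp u 2) (hg2 : MemLp g 2)
    (hu : HasWeakPartialDeriv i u g) (hφ : LipschitzWith C φ) (hB : ∀ x, |φ x| ≤ B) :
    HasWeakPartialDeriv i (fun x => φ x * u x) (fun x => partialDeriv i φ x * u x + φ x * g x) :=
  of_test fun η hη => by
    obtain ⟨D, hD⟩ := hη.exists_lipschitzWith
    obtain ⟨A, hA⟩ := hη.exists_bound
    have hA' : ∀ x, |η x| ≤ A.toNNReal := fun x => (hA x).trans (Real.le_coe_toNNReal _)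
    have hB' : ∀ x, |φ x| ≤ B.toNNReal := fun x => (hB x).trans (Real.le_coe_toNNReal _)
    -- `φ η` is not smooth, but it is Lipschitz with compact support, hence of class `W₂¹`, and the
    -- symmetric integration by parts accepts it in place of a test function.
    have hw := lipschitzWith_mul_of_bounded hD hφ hA' hB'
    have hws : HasCompactSupport fun x => φ x * η x := hη.hasCompactSupport.mul_left
    have h1 := integral_mul_eq_neg hu2 hg2 (hw.continuous.memLp_of_hasCompactSupport hws)
      (memLp_partialDeriv_of_lipschitz hw hws i) hu (hasWeakPartialDeriv_of_lipschitz hw i)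
    have hdφ := hu2.bounded_mul (aestronglyMeasurable_partialDeriv hφ.continuous i)
      (abs_partialDeriv_le_of_lipschitz hφ i)
    have hφm : AEStronglyMeasurable φ (volume : Measure (EuclideanSpace ℝ (Fin n))) :=
      hφ.continuous.aestronglyMeasurable
    have h2 : ∫ x, u x * partialDeriv i (fun x => φ x * η x) x
        = (∫ x, partialDeriv i φ x * u x * η x) + ∫ x, φ x * u x * partialDeriv i η x := by
      rw [← integral_add (hdφ.integrable_mul_two hη.memLp)
        ((hu2.bounded_mul hφm hB).integrable_mul_two (hη.partialDeriv i).memLp)]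
      refine integral_congr_ae ?_
      filter_upwards [partialDeriv_mul_ae hφ hη i] with x hx
      rw [hx]; ring
    have h3 : ∫ x, (partialDeriv i φ x * u x + φ x * g x) * η x
        = (∫ x, partialDeriv i φ x * u x * η x) + ∫ x, g x * (φ x * η x) := by
      rw [← integral_add (hdφ.integrable_mul_two hη.memLp) (by
        refine ((hg2.bounded_mul hφm hB).integrable_mul_two hη.memLp).congr
          (Eventually.of_forall fun x => ?_)
        ring)]
      congr 1; ext x; ring
    rw [h3]
    linarith

end Lipschitz

/-! ### Maps of bounded compression and their transfer operators. -/

/-- Lebesgue measure is a multiple of `n`-dimensional Hausdorff measure, which a `K`-Lipschitz map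
enlarges by at most `K ^ n`. -/
theorem LipschitzWith.volume_image_le {n : ℕ} {K : ℝ≥0}
    {Z : EuclideanSpace ℝ (Fin n) → EuclideanSpace ℝ (Fin n)} (hZ : LipschitzWith K Z)
    (B : Set (EuclideanSpace ℝ (Fin n))) : volume (Z '' B) ≤ (K ^ n : ℝ≥0) * volume B := by
  have e := Measure.isAddLeftInvariant_eq_smul
    (volume : Measure (EuclideanSpace ℝ (Fin n))) (Measure.hausdorffMeasure (n : ℝ))
  have h := hZ.hausdorffMeasure_image_le (d := n) (by positivity) B
  rw [e]
  simp only [Measure.smul_apply, ENNReal.smul_def, smul_eq_mul]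
  rw [mul_left_comm]
  gcongr
  simpa using h

/-- `X` is measurable and pushes Lebesgue measure forward to at most `C` times itself. -/
structure HasBoundedCompression {n : ℕ}
    (X : EuclideanSpace ℝ (Fin n) → EuclideanSpace ℝ (Fin n)) (C : ℝ≥0) : Prop where
  measurable : Measurable X
  map_le : (volume : Measure (EuclideanSpace ℝ (Fin n))).map X ≤ (C : ℝ≥0∞) • volume

/-- The preimage of `B` under `X` lies in the image of `B` under the Lipschitz map `Z`; no Jacobian
determinant is involved. -/
theorem HasBoundedCompression.of_leftInverse {n : ℕ} {K : ℝ≥0}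
    {X Z : EuclideanSpace ℝ (Fin n) → EuclideanSpace ℝ (Fin n)} (hX : Measurable X)
    (hZ : LipschitzWith K Z) (hZX : Function.LeftInverse Z X) :
    HasBoundedCompression X (K ^ n) := by
  refine ⟨hX, Measure.le_iff.2 fun B hB => ?_⟩
  rw [Measure.map_apply hX hB]
  refine (measure_mono fun x hx => ?_).trans (hZ.volume_image_le B)
  exact ⟨X x, hx, hZX x⟩

namespace HasBoundedCompression

variable {n : ℕ} {X : EuclideanSpace ℝ (Fin n) → EuclideanSpace ℝ (Fin n)} {C : ℝ≥0}

theorem quasiMeasurePreserving (hX : HasBoundedCompression X C) :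
    Measure.QuasiMeasurePreserving X (volume : Measure (EuclideanSpace ℝ (Fin n))) volume :=
  ⟨hX.measurable, (Measure.absolutelyContinuous_of_le hX.map_le).trans
    (Measure.smul_absolutelyContinuous)⟩

theorem eLpNorm_comp_le (hX : HasBoundedCompression X C) {g : EuclideanSpace ℝ (Fin n) → ℝ}
    (hg : AEStronglyMeasurable g volume) :
    eLpNorm (g ∘ X) 2 volume ≤ (C ^ (1 / 2 : ℝ) : ℝ≥0) * eLpNorm g 2 volume := by
  rw [← eLpNorm_map_measure (hg.mono_ac hX.quasiMeasurePreserving.absolutelyContinuous)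
    hX.measurable.aemeasurable]
  refine (eLpNorm_mono_measure g hX.map_le).trans ?_
  rw [eLpNorm_smul_measure_of_ne_top (by norm_num)]
  simp [ENNReal.coe_rpow_of_nonneg]

theorem memLp_comp (hX : HasBoundedCompression X C) {g : EuclideanSpace ℝ (Fin n) → ℝ}
    (hg : MemLp g 2) : MemLp (g ∘ X) 2 :=
  ⟨hg.1.comp_quasiMeasurePreserving hX.quasiMeasurePreserving,
    (hX.eLpNorm_comp_le hg.1).trans_lt (ENNReal.mul_lt_top ENNReal.coe_lt_top hg.2)⟩

/-- The composition operator `g ↦ g ∘ X` on `L₂`. -/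
def koopman (hX : HasBoundedCompression X C) : H0 n →L[ℝ] H0 n :=
  LinearMap.mkContinuous
    { toFun := fun g => (hX.memLp_comp (Lp.memLp g)).toLp (g ∘ X)
      map_add' := fun g h => by
        rw [← MemLp.toLp_add]
        refine MemLp.toLp_congr _ _ ?_
        exact hX.quasiMeasurePreserving.ae_eq_comp (Lp.coeFn_add g h)
      map_smul' := fun c g => by
        rw [RingHom.id_apply, ← MemLp.toLp_const_smul]
        refine MemLp.toLp_congr _ _ ?_
        exact hX.quasiMeasurePreserving.ae_eq_comp (Lp.coeFn_smul c g) }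
    (C ^ (1 / 2 : ℝ) : ℝ≥0) fun g => by
      change ‖(hX.memLp_comp (Lp.memLp g)).toLp (g ∘ X)‖ ≤ _
      rw [Lp.norm_toLp, Lp.norm_def, ← ENNReal.coe_toReal, ← ENNReal.toReal_mul]
      exact ENNReal.toReal_mono (ENNReal.mul_ne_top ENNReal.coe_ne_top (Lp.eLpNorm_ne_top g))
        (hX.eLpNorm_comp_le (Lp.memLp g).1)

theorem koopman_toLp (hX : HasBoundedCompression X C) {g : EuclideanSpace ℝ (Fin n) → ℝ}
    (hg : MemLp g 2) : hX.koopman (hg.toLp g) = (hX.memLp_comp hg).toLp (g ∘ X) :=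
  MemLp.toLp_congr (hX.memLp_comp (Lp.memLp _)) _
    (hX.quasiMeasurePreserving.ae_eq_comp hg.coeFn_toLp)

theorem norm_koopman_le (hX : HasBoundedCompression X C) :
    ‖hX.koopman‖ ≤ (C ^ (1 / 2 : ℝ) : ℝ≥0) :=
  LinearMap.mkContinuous_norm_le _ (NNReal.coe_nonneg _) _

/-- The transfer operator, adjoint to composition with `X`: it sends a density to the density of
its image under `X`. -/
def transfer (hX : HasBoundedCompression X C) : H0 n →L[ℝ] H0 n :=
  ContinuousLinearMap.adjoint hX.koopman

theorem norm_transfer_le (hX : HasBoundedCompression X C) :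
    ‖hX.transfer‖ ≤ (C ^ (1 / 2 : ℝ) : ℝ≥0) := by
  rw [transfer, LinearIsometryEquiv.norm_map]
  exact hX.norm_koopman_le

theorem inner_transfer_left (hX : HasBoundedCompression X C) (ρ u : H0 n) :
    inner ℝ (hX.transfer ρ) u = inner ℝ ρ (hX.koopman u) :=
  ContinuousLinearMap.adjoint_inner_left _ _ _

theorem inner_transfer_toLp (hX : HasBoundedCompression X C) (ρ : H0 n)
    {g : EuclideanSpace ℝ (Fin n) → ℝ} (hg : MemLp g 2) :
    inner ℝ (hX.transfer ρ) (hg.toLp g) = ∫ x, ρ x * g (X x) := by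
  rw [inner_transfer_left, koopman_toLp, H0.inner_toLp_right]
  rfl

end HasBoundedCompression

/-! ### Transfer operators preserve `W₂¹`. -/

section Inverse

variable {n : ℕ} {X Z : EuclideanSpace ℝ (Fin n) → EuclideanSpace ℝ (Fin n)} {A B D : ℝ≥0}

/-- A Lipschitz map whose second differences are controlled has, almost everywhere, directional
derivatives which agree with bounded Lipschitz functions. -/
theorem exists_lipschitz_lineDeriv (hZ : LipschitzWith B Z)
    (hZ2 : ∀ x y v, ‖Z (x + v) - Z x - (Z (y + v) - Z y)‖ ≤ D * ‖v‖ * ‖x - y‖) (k : Fin n) :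
    ∃ W : Fin n → EuclideanSpace ℝ (Fin n) → ℝ,
      (∀ j, LipschitzWith D (W j)) ∧ (∀ j y, |W j y| ≤ B) ∧
      ∀ᵐ y, LineDifferentiableAt ℝ Z y (EuclideanSpace.single k 1) ∧
        ∀ j, lineDeriv ℝ Z y (EuclideanSpace.single k 1) j = W j y := by
  set e : EuclideanSpace ℝ (Fin n) := EuclideanSpace.single k 1 with he
  have hen : ‖e‖ = 1 := by simp [he]
  set S : Set (EuclideanSpace ℝ (Fin n)) := {y | LineDifferentiableAt ℝ Z y e} with hS
  have hSae : ∀ᵐ y : EuclideanSpace ℝ (Fin n), y ∈ S := by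
    filter_upwards [hZ.ae_differentiableAt (μ := volume)] with y hy
    exact hy.lineDifferentiableAt
  -- The second-difference bound on `Z`, divided by the step length, passes to the limit wherever
  -- the derivative exists; real-valued Lipschitz extension then fills in the null set, component by
  -- component.
  have hlip : ∀ x ∈ S, ∀ y ∈ S, ‖lineDeriv ℝ Z x e - lineDeriv ℝ Z y e‖ ≤ D * ‖x - y‖ := by
    intro x hx y hy
    have h1 := hasDerivAt_iff_tendsto_slope_zero.1 hx.hasLineDerivAt
    have h2 := hasDerivAt_iff_tendsto_slope_zero.1 hy.hasLineDerivAt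
    refine le_of_tendsto (h1.sub h2).norm ?_
    filter_upwards [self_mem_nhdsWithin] with t ht
    simp only [zero_add, zero_smul, add_zero]
    rw [← smul_sub, norm_smul, norm_inv, inv_mul_le_iff₀ (norm_pos_iff.2 ht)]
    refine (hZ2 x y (t • e)).trans_eq ?_
    rw [norm_smul, hen]; ring
  have hW : ∀ j, ∃ W : EuclideanSpace ℝ (Fin n) → ℝ, LipschitzWith D W ∧
      EqOn (fun y => lineDeriv ℝ Z y e j) W S := fun j =>
    LipschitzOnWith.extend_real (LipschitzOnWith.of_dist_le_mul fun x hx y hy => by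
      rw [Real.dist_eq, dist_eq_norm]
      exact (PiLp.norm_apply_le (lineDeriv ℝ Z x e - lineDeriv ℝ Z y e) j).trans
        (hlip x hx y hy))
  choose W hWl hWe using hW
  refine ⟨W, hWl, fun j => ?_, ?_⟩
  · have hdense : Dense S := Measure.dense_of_ae hSae
    have hcl : IsClosed {y | |W j y| ≤ B} :=
      isClosed_le (hWl j).continuous.abs continuous_const
    have hsub : S ⊆ {y | |W j y| ≤ B} := fun y hy => by
      have h1 := norm_lineDeriv_le_of_lipschitz ℝ hZ (x₀ := y) (v := e)
      rw [hen, mul_one] at h1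
      have h2 := PiLp.norm_apply_le (lineDeriv ℝ Z y e) j
      rw [mem_ofPred_eq, ← hWe j hy]
      exact h2.trans h1
    intro y
    exact (hcl.closure_subset_iff.2 hsub) (hdense y)
  · filter_upwards [hSae] with y hy
    exact ⟨hy, fun j => hWe j hy⟩

theorem hasCompactSupport_comp_of_inverse (hZ : Continuous Z) (hZX : Function.LeftInverse Z X)
    {η : EuclideanSpace ℝ (Fin n) → ℝ} (hη : HasCompactSupport η) :
    HasCompactSupport (η ∘ X) :=
  HasCompactSupport.intro (hη.isCompact.image hZ) fun x hx => by
    by_contra h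
    exact hx ⟨X x, subset_tsupport _ h, hZX x⟩

/-- The transfer operator of a sufficiently regular map preserves `W₂¹`. -/
theorem exists_hasWeakPartialDeriv_transfer (hX : LipschitzWith A X) (hZ : LipschitzWith B Z)
    (hZX : Function.LeftInverse Z X) (hXZ : Function.RightInverse Z X)
    (hZ2 : ∀ x y v, ‖Z (x + v) - Z x - (Z (y + v) - Z y)‖ ≤ D * ‖v‖ * ‖x - y‖)
    {C : ℝ≥0} (hXC : HasBoundedCompression X C) {ρ : H0 n} {G : Fin n → H0 n}
    (hG : ∀ j, HasWeakPartialDeriv j ρ (G j)) (k : Fin n) :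
    ∃ g : H0 n, HasWeakPartialDeriv k (hXC.transfer ρ) g ∧
      ‖g‖ ≤ ‖hXC.transfer‖ * ∑ j, (D * A * ‖ρ‖ + B * ‖G j‖) := by
  obtain ⟨W, hWl, hWb, hWe⟩ := exists_lipschitz_lineDeriv hZ hZ2 k
  -- `V j x` stands for `∂ₖ Zⱼ` at `X x`, and is Lipschitz in `x`.
  set V : Fin n → EuclideanSpace ℝ (Fin n) → ℝ := fun j => W j ∘ X with hV
  have hVl : ∀ j, LipschitzWith (D * A) (V j) := fun j => (hWl j).comp hX
  have hVb : ∀ j x, |V j x| ≤ B := fun j x => hWb j _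
  have hm1 : ∀ j, MemLp (fun x => partialDeriv j (V j) x * ρ x) 2 := fun j =>
    (Lp.memLp ρ).bounded_mul (aestronglyMeasurable_partialDeriv (hVl j).continuous j)
      (abs_partialDeriv_le_of_lipschitz (hVl j) j)
  have hm2 : ∀ j, MemLp (fun x => V j x * G j x) 2 := fun j =>
    (Lp.memLp (G j)).bounded_mul (hVl j).continuous.aestronglyMeasurable (hVb j)
  have hm0 : ∀ j, MemLp (fun x => V j x * ρ x) 2 := fun j =>
    (Lp.memLp ρ).bounded_mul (hVl j).continuous.aestronglyMeasurable (hVb j)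
  -- `N j` is the weak derivative `∂ⱼ (Vⱼ ρ)`, given by the product rule.
  set N : Fin n → H0 n := fun j => (hm1 j).toLp _ + (hm2 j).toLp _ with hN
  have hNe : ∀ j, N j =ᵐ[volume]
      fun x => partialDeriv j (V j) x * ρ x + V j x * G j x := fun j => by
    filter_upwards [Lp.coeFn_add ((hm1 j).toLp _) ((hm2 j).toLp _), (hm1 j).coeFn_toLp,
      (hm2 j).coeFn_toLp] with x h1 h2 h3
    rw [h1, Pi.add_apply, h2, h3]
  refine ⟨hXC.transfer (∑ j, N j), ?_, ?_⟩
  · refine HasWeakPartialDeriv.of_test fun η hη => ?_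
    obtain ⟨Lη, hLη⟩ := hη.exists_lipschitzWith
    have hw : LipschitzWith (Lη * A) (η ∘ X) := hLη.comp hX
    have hws : HasCompactSupport (η ∘ X) :=
      hasCompactSupport_comp_of_inverse hZ.continuous hZX hη.hasCompactSupport
    have hw2 : MemLp (η ∘ X) 2 := hXC.memLp_comp hη.memLp
    have hdw := memLp_partialDeriv_of_lipschitz hw hws
    -- Chain rule for `η = (η ∘ X) ∘ Z` at the point `X x`. By Rademacher `η ∘ X` is differentiable
    -- almost everywhere, and the exceptional set of `Z` pulls back under `X` to a null set.
    have hchain : ∀ᵐ x, partialDeriv k η (X x) = ∑ j, V j x * partialDeriv j (η ∘ X) x := by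
      filter_upwards [hw.ae_differentiableAt (μ := volume), hXC.quasiMeasurePreserving.ae hWe]
        with x h1 h2
      obtain ⟨h2, h3⟩ := h2
      have hZx : Z (X x) = x := hZX x
      have h4 := h1.hasFDerivAt
      have h5 : HasDerivAt (fun t : ℝ => (η ∘ X) (Z (X x + t • EuclideanSpace.single k (1:ℝ))))
          (fderiv ℝ (η ∘ X) x (lineDeriv ℝ Z (X x) (EuclideanSpace.single k 1))) 0 :=
        HasFDerivAt.comp_hasDerivAt (l := η ∘ X)
          (f := fun t : ℝ => Z (X x + t • EuclideanSpace.single k (1:ℝ))) (0:ℝ)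
          (by simp only [zero_smul, add_zero, hZx]; exact h4) h2.hasLineDerivAt
      have h6 : partialDeriv k η (X x)
          = fderiv ℝ (η ∘ X) x (lineDeriv ℝ Z (X x) (EuclideanSpace.single k 1)) := by
        rw [← h5.deriv]
        simp only [Function.comp, hXZ _]
        rfl
      rw [h6, ← (EuclideanSpace.basisFun (Fin n) ℝ).sum_repr (lineDeriv ℝ Z (X x) _), map_sum]
      refine Finset.sum_congr rfl fun j _ => ?_
      rw [map_smul, EuclideanSpace.basisFun_repr, h3 j, EuclideanSpace.basisFun_apply,
        partialDeriv, h1.lineDeriv_eq_fderiv]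
      rfl
    have e1 : ∫ x, hXC.transfer ρ x * partialDeriv k η x
        = ∫ x, ρ x * partialDeriv k η (X x) := by
      rw [← hXC.inner_transfer_toLp ρ (hη.partialDeriv k).memLp, H0.inner_toLp_right]
    have e2 : ∫ x, hXC.transfer (∑ j, N j) x * η x = ∑ j, ∫ x, N j x * η (X x) := by
      rw [← H0.inner_toLp_right _ hη.memLp, map_sum, sum_inner]
      exact Finset.sum_congr rfl fun j _ => hXC.inner_transfer_toLp _ _
    have e3 : ∫ x, ρ x * partialDeriv k η (X x)
        = ∑ j, ∫ x, (V j x * ρ x) * partialDeriv j (η ∘ X) x := by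
      rw [← integral_finsetSum _ fun j _ => (hm0 j).integrable_mul_two (hdw j)]
      refine integral_congr_ae ?_
      filter_upwards [hchain] with x hx
      rw [hx, Finset.mul_sum]
      exact Finset.sum_congr rfl fun j _ => by ring
    rw [e1, e2, e3, ← Finset.sum_neg_distrib]
    refine Finset.sum_congr rfl fun j _ => ?_
    have hprod := ((hG j).lipschitz_mul (Lp.memLp ρ) (Lp.memLp (G j)) (hVl j) (hVb j)).congr
      (Eventually.of_forall fun _ => rfl) (hNe j).symm
    exact hprod.integral_mul_eq_neg (hm0 j) (Lp.memLp _) hw2 (hdw j)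
      (hasWeakPartialDeriv_of_lipschitz hw j)
  · refine (hXC.transfer.le_opNorm _).trans (mul_le_mul_of_nonneg_left ?_ (norm_nonneg _))
    refine (norm_sum_le _ _).trans (Finset.sum_le_sum fun j _ => ?_)
    refine (norm_add_le _ _).trans (add_le_add ?_ ?_)
    · refine Lp.norm_le_mul_norm_of_ae_le_mul ?_
      filter_upwards [(hm1 j).coeFn_toLp] with x hx
      rw [hx, norm_mul]
      exact mul_le_mul_of_nonneg_right (abs_partialDeriv_le_of_lipschitz (hVl j) j x)
        (norm_nonneg _)
    · refine Lp.norm_le_mul_norm_of_ae_le_mul ?_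
      filter_upwards [(hm2 j).coeFn_toLp] with x hx
      rw [hx, norm_mul]
      exact mul_le_mul_of_nonneg_right (hVb j x) (norm_nonneg _)

end Inverse

/-! ### Constancy from small increments, and measurability of `L₂`-valued maps. -/

theorem eq_of_abs_sub_le_sq {G : ℝ → ℝ} {C : ℝ} (hG : ∀ a b, |G b - G a| ≤ C * |b - a| ^ 2)
    (a b : ℝ) : G a = G b := by
  have hd : ∀ t, HasDerivAt G 0 t := fun t => by
    have h1 : (fun x => G x - G t) =O[𝓝 t] fun x => ‖x - t‖ ^ 2 :=
      Asymptotics.IsBigO.of_bound C (Eventually.of_forall fun x => by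
        simpa using hG t x)
    have h2 : HasFDerivAt (fun x => G x - G t) (0 : ℝ →L[ℝ] ℝ) t := h1.hasFDerivAt (by norm_num)
    have h3 := (h2.add_const (G t)).hasDerivAt
    simpa using h3
  exact is_const_of_deriv_eq_zero (fun t => (hd t).differentiableAt) (fun t => (hd t).deriv) a b

/-- Weak measurability implies measurability in a separable space: a closed ball about `c` is the
intersection of the countably many half-spaces given by a dense sequence of directions. -/
theorem measurable_of_measurable_inner {α H : Type*} [MeasurableSpace α] [NormedAddCommGroup H]
    [InnerProductSpace ℝ H] [SecondCountableTopology H] [MeasurableSpace H] [BorelSpace H]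
    {u : α → H} {S : Set H} (hS : Dense S)
    (hu : ∀ w ∈ S, Measurable fun a => inner ℝ (u a) w) : Measurable u := by
  have hall : ∀ w, Measurable fun a => inner ℝ (u a) w := fun w => by
    obtain ⟨x, hx, hlim⟩ := mem_closure_iff_seq_limit.1 (hS w)
    refine measurable_of_tendsto_metrizable (fun k => hu (x k) (hx k)) ?_
    rw [tendsto_pi_nhds]
    exact fun a => tendsto_const_nhds.inner hlim
  have hball : ∀ c r, 0 ≤ r → MeasurableSet {a | ‖u a - c‖ ≤ r} := fun c r hr => by
    have e : {a | ‖u a - c‖ ≤ r}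
        = ⋂ k : ℕ, {a | inner ℝ (u a) (TopologicalSpace.denseSeq H k)
          - inner ℝ c (TopologicalSpace.denseSeq H k) ≤ r * ‖TopologicalSpace.denseSeq H k‖} := by
      ext a
      simp only [mem_ofPred_eq, mem_iInter, ← inner_sub_left]
      refine ⟨fun h k => (real_inner_le_norm _ _).trans
        (mul_le_mul_of_nonneg_right h (norm_nonneg _)), fun h => ?_⟩
      have hcl : IsClosed {w : H | inner ℝ (u a - c) w ≤ r * ‖w‖} :=
        isClosed_le (by fun_prop) (by fun_prop)
      have h1 : u a - c ∈ {w : H | inner ℝ (u a - c) w ≤ r * ‖w‖} :=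
        hcl.closure_subset_iff.2 (by rintro _ ⟨k, rfl⟩; exact h k)
          ((TopologicalSpace.denseRange_denseSeq H) _)
      rw [mem_ofPred_eq, real_inner_self_eq_norm_mul_norm] at h1
      rcases eq_or_lt_of_le (norm_nonneg (u a - c)) with h2 | h2
      · rw [← h2]; exact hr
      · exact le_of_mul_le_mul_right h1 h2
    rw [e]
    exact MeasurableSet.iInter fun k => measurableSet_le ((hall _).sub_const _) measurable_const
  have hdist : ∀ c, Measurable fun a => ‖u a - c‖ := fun c => by
    refine measurable_of_Iic fun r => ?_
    rcases le_or_gt 0 r with hr | hr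
    · exact hball c r hr
    · convert MeasurableSet.empty
      ext a
      simp only [mem_preimage, mem_Iic, mem_empty_iff_false, iff_false, not_le]
      exact hr.trans_le (norm_nonneg _)
  have hbasis : TopologicalSpace.IsTopologicalBasis {B : Set H | ∃ c r, B = Metric.ball c r} := by
    refine TopologicalSpace.isTopologicalBasis_of_isOpen_of_nhds ?_ fun a U ha hU => ?_
    · rintro _ ⟨c, r, rfl⟩; exact Metric.isOpen_ball
    · obtain ⟨ε, hε, hεU⟩ := Metric.isOpen_iff.1 hU a ha
      exact ⟨_, ⟨a, ε, rfl⟩, Metric.mem_ball_self hε, hεU⟩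
  rw [BorelSpace.measurable_eq (α := H), hbasis.borel_eq_generateFrom]
  refine measurable_generateFrom ?_
  rintro _ ⟨c, r, rfl⟩
  have : u ⁻¹' Metric.ball c r = {a | ‖u a - c‖ < r} := by ext a; simp [dist_eq_norm]
  rw [this]
  exact measurableSet_lt (hdist c) measurable_const

instance (n : ℕ) : SecondCountableTopology (H0 n) :=
  haveI : Fact ((2 : ℝ≥0∞) ≠ ⊤) := ⟨by norm_num⟩
  Lp.SecondCountableTopology

theorem H0.measurable_of_test {α : Type*} [MeasurableSpace α] {n : ℕ} [MeasurableSpace (H0 n)]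
    [BorelSpace (H0 n)] {u : α → H0 n}
    (hu : ∀ (η : EuclideanSpace ℝ (Fin n) → ℝ) (hη : IsTestFunction η),
      Measurable fun a => inner ℝ (u a) (hη.memLp.toLp η)) : Measurable u :=
  measurable_of_measurable_inner (dense_testSubmodule n) (by rintro _ ⟨η, hη, rfl⟩; exact hu η hη)

theorem H0.stronglyMeasurable_of_test {α : Type*} [MeasurableSpace α] {n : ℕ} {u : α → H0 n}
    (hu : ∀ (η : EuclideanSpace ℝ (Fin n) → ℝ) (hη : IsTestFunction η),
      Measurable fun a => inner ℝ (u a) (hη.memLp.toLp η)) : StronglyMeasurable u := by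
  borelize (H0 n)
  exact (H0.measurable_of_test hu).stronglyMeasurable

/-! ### Test functions along trajectories. -/

namespace IsTestFunction

variable {n : ℕ} {η : EuclideanSpace ℝ (Fin n) → ℝ}

theorem fderiv_apply_eq_sum (hη : IsTestFunction η) (x v : EuclideanSpace ℝ (Fin n)) :
    fderiv ℝ η x v = ∑ i, v i * _root_.partialDeriv i η x := by
  conv_lhs => rw [← (EuclideanSpace.basisFun (Fin n) ℝ).sum_repr v, map_sum]
  refine Finset.sum_congr rfl fun i _ => ?_
  rw [map_smul, EuclideanSpace.basisFun_repr, EuclideanSpace.basisFun_apply, hη.partialDeriv_eq,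
    smul_eq_mul]

theorem exists_lipschitzWith_fderiv (hη : IsTestFunction η) :
    ∃ C, LipschitzWith C (fderiv ℝ η) :=
  (hη.contDiff.fderiv_right (m := ∞) (by simp)).lipschitzWith_of_hasCompactSupport
    (hη.hasCompactSupport.fderiv ℝ) (by simp)

theorem exists_abs_fderiv_apply_le (hη : IsTestFunction η) :
    ∃ C : ℝ, 0 ≤ C ∧ ∀ x v, |fderiv ℝ η x v| ≤ C * ‖v‖ := by
  obtain ⟨C, hC⟩ := hη.exists_lipschitzWith
  exact ⟨C, C.2, fun x v => ((fderiv ℝ η x).le_opNorm v).trans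
    (mul_le_mul_of_nonneg_right (norm_fderiv_le_of_lipschitz ℝ hC) (norm_nonneg _))⟩

theorem exists_taylor_bound (hη : IsTestFunction η) :
    ∃ C : ℝ, 0 ≤ C ∧ (∀ a b v, |fderiv ℝ η b v - fderiv ℝ η a v| ≤ C * ‖b - a‖ * ‖v‖) ∧
      ∀ a b, |η b - η a - fderiv ℝ η a (b - a)| ≤ C * ‖b - a‖ ^ 2 := by
  obtain ⟨C, hC⟩ := hη.exists_lipschitzWith_fderiv
  refine ⟨C, C.2, fun a b v => ?_, fun a b => ?_⟩
  · rw [← sub_apply]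
    refine ((fderiv ℝ η b - fderiv ℝ η a).le_opNorm v).trans
      (mul_le_mul_of_nonneg_right ?_ (norm_nonneg _))
    simpa [dist_eq_norm] using hC.dist_le_mul b a
  · have := Convex.norm_image_sub_le_of_norm_fderiv_le' (f := η) (φ := fderiv ℝ η a)
      (C := C * ‖b - a‖) (s := segment ℝ a b) (x := a) (y := b)
      (fun x _ => hη.differentiable x) (fun x hx => ?_) (convex_segment a b)
      (left_mem_segment ℝ a b) (right_mem_segment ℝ a b)
    · rw [pow_two, ← mul_assoc]; exact this
    · rw [← dist_eq_norm, ← dist_eq_norm]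
      refine (hC.dist_le_mul x a).trans (mul_le_mul_of_nonneg_left ?_ C.2)
      obtain ⟨θ, hθ, rfl⟩ := (segment_eq_image' ℝ a b) ▸ hx
      rw [dist_eq_norm, dist_eq_norm, add_sub_cancel_left, norm_smul, Real.norm_of_nonneg hθ.1]
      exact mul_le_of_le_one_left (norm_nonneg _) hθ.2

end IsTestFunction

namespace IsTameField

variable {n : ℕ} {F : ℝ → EuclideanSpace ℝ (Fin n) → EuclideanSpace ℝ (Fin n)} {M L L₂ : ℝ}
  {η : EuclideanSpace ℝ (Fin n) → ℝ}

theorem measurable_fderiv_apply_flow (hF : IsTameField F M L L₂) (hη : IsTestFunction η) (s : ℝ) :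
    Measurable fun z : ℝ × EuclideanSpace ℝ (Fin n) =>
      fderiv ℝ η (hF.flow s z.1 z.2) (F z.1 (hF.flow s z.1 z.2)) := by
  have hfl := (hF.continuous_uncurry_flow s).measurable
  simp only [hη.fderiv_apply_eq_sum]
  refine Finset.measurable_sum _ fun i _ => ?_
  exact ((EuclideanSpace.proj i).continuous.measurable.comp
    (hF.meas.comp (measurable_fst.prodMk hfl))).mul
    ((hη.partialDeriv i).contDiff.continuous.measurable.comp hfl)

/-- The field is only measurable in time, so trajectories need not be differentiable at a given
time. Instead, the difference of the two sides changes by `O(|b - a|²)` on an interval `[a, b]` and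
is therefore constant. -/
theorem test_flow_eq (hF : IsTameField F M L L₂) (hη : IsTestFunction η) (s t : ℝ)
    (x : EuclideanSpace ℝ (Fin n)) :
    η (hF.flow s t x) = η x
      + ∫ r in s..t, fderiv ℝ η (hF.flow s r x) (F r (hF.flow s r x)) := by
  obtain ⟨C₁, hC₁0, hC₁⟩ := hη.exists_abs_fderiv_apply_le
  obtain ⟨C, hC0, hC2, hC3⟩ := hη.exists_taylor_bound
  set y : ℝ → EuclideanSpace ℝ (Fin n) := fun r => hF.flow s r x with hy
  set φ : ℝ → ℝ := fun r => fderiv ℝ η (y r) (F r (y r)) with hφ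
  have hM := hF.M_nonneg
  have hφi : ∀ a b, IntervalIntegrable φ volume a b := fun a b => by
    rw [intervalIntegrable_iff]
    have : IsFiniteMeasure (volume.restrict (uIoc a b)) := ⟨by simp [uIoc]⟩
    refine Integrable.of_bound (C := C₁ * M) ?_ (Eventually.of_forall fun r => ?_)
    · exact ((hF.measurable_fderiv_apply_flow hη s).comp
        (measurable_id.prodMk measurable_const)).aestronglyMeasurable
    · exact (hC₁ _ _).trans (mul_le_mul_of_nonneg_left (hF.bound _ _) hC₁0)
  -- One `C M²` comes from the Taylor remainder of `η`, the other from freezing the derivative of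
  -- `η` at `y a`.
  have key : ∀ a b, |(η (y b) - ∫ r in s..b, φ r) - (η (y a) - ∫ r in s..a, φ r)|
      ≤ (2 * (C * M ^ 2)) * |b - a| ^ 2 := by
    intro a b
    have hab : (∫ r in s..b, φ r) = (∫ r in s..a, φ r) + ∫ r in a..b, φ r :=
      (intervalIntegral.integral_add_adjacent_intervals (hφi _ _) (hφi _ _)).symm
    have hyab : y b - y a = ∫ r in a..b, F r (y r) := by
      simp only [hy]; rw [hF.flow_eq_add s a b, add_sub_cancel_left]
    have hFi := hF.integrable_along_flow s x a b
    have h1 : fderiv ℝ η (y a) (y b - y a) = ∫ r in a..b, fderiv ℝ η (y a) (F r (y r)) := by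
      rw [hyab, (fderiv ℝ η (y a)).intervalIntegral_comp_comm hFi]
    have hi : IntervalIntegrable (fun r => fderiv ℝ η (y a) (F r (y r))) volume a b :=
      ⟨(fderiv ℝ η (y a)).integrable_comp hFi.1, (fderiv ℝ η (y a)).integrable_comp hFi.2⟩
    have h2 : |∫ r in a..b, (fderiv ℝ η (y a) (F r (y r)) - φ r)|
        ≤ (C * (M * |b - a|) * M) * |b - a| := by
      rw [← Real.norm_eq_abs]
      refine intervalIntegral.norm_integral_le_of_norm_le_const fun r hr => ?_
      rw [norm_sub_rev]
      refine (hC2 _ _ _).trans ?_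
      have h3 : ‖y r - y a‖ ≤ M * |b - a| :=
        (hF.norm_flow_sub_flow_time_le s a r x).trans
          (mul_le_mul_of_nonneg_left (abs_sub_left_of_mem_uIcc (uIoc_subset_uIcc hr)) hM)
      have h4 := hF.bound r (y r)
      gcongr
    rw [intervalIntegral.integral_sub hi (hφi _ _), ← h1] at h2
    have h5 := hC3 (y a) (y b)
    have h6 : ‖y b - y a‖ ^ 2 ≤ (M * |b - a|) ^ 2 :=
      pow_le_pow_left₀ (norm_nonneg _) (hF.norm_flow_sub_flow_time_le s a b x) 2
    have h7 := mul_le_mul_of_nonneg_left h6 hC0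
    calc _ = |(η (y b) - η (y a) - fderiv ℝ η (y a) (y b - y a))
          + (fderiv ℝ η (y a) (y b - y a) - ∫ r in a..b, φ r)| := by rw [hab]; congr 1; ring
      _ ≤ C * (M * |b - a|) ^ 2 + (C * (M * |b - a|) * M) * |b - a| :=
        (abs_add_le _ _).trans (add_le_add (h5.trans h7) h2)
      _ = _ := by ring
  have := eq_of_abs_sub_le_sq key t s
  simp only [intervalIntegral.integral_same, sub_zero] at this
  have e : y s = x := hF.flow_self s x
  rw [e] at this
  linarith

/-! ### Transport of densities along the flow. -/

theorem hasBoundedCompression_flow (hF : IsTameField F M L L₂) (s t : ℝ) :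
    HasBoundedCompression (hF.flow s t) ((Real.exp (L * |s - t|)).toNNReal ^ n) :=
  HasBoundedCompression.of_leftInverse (hF.continuous_flow s t).measurable
    (hF.lipschitzWith_flow t s) fun x => by rw [flow_flow, flow_self]

/-- The operator which maps a density at time `s` to the density at time `t` of its image under
the flow. -/
def transferFlow (hF : IsTameField F M L L₂) (s t : ℝ) : H0 n →L[ℝ] H0 n :=
  (hF.hasBoundedCompression_flow s t).transfer

theorem norm_transferFlow_le (hF : IsTameField F M L L₂) (s t : ℝ) :
    ‖hF.transferFlow s t‖ ≤ Real.exp (L * |s - t|) ^ n := by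
  refine (hF.hasBoundedCompression_flow s t).norm_transfer_le.trans ?_
  have h1 : (1 : ℝ≥0) ≤ (Real.exp (L * |s - t|)).toNNReal ^ n := by
    refine one_le_pow₀ ?_
    rw [Real.one_le_toNNReal]
    exact Real.one_le_exp (mul_nonneg hF.L_nonneg (abs_nonneg _))
  -- The compression constant is at least `1`, so its square root may be replaced by the constant
  -- itself.
  have h2 := NNReal.rpow_le_rpow_of_exponent_le h1 (by norm_num : (1/2 : ℝ) ≤ 1)
  rw [NNReal.rpow_one] at h2
  refine (NNReal.coe_le_coe.2 h2).trans_eq ?_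
  rw [NNReal.coe_pow, Real.coe_toNNReal _ (Real.exp_pos _).le]

theorem inner_transferFlow_toLp (hF : IsTameField F M L L₂) (s t : ℝ) (ρ : H0 n)
    {g : EuclideanSpace ℝ (Fin n) → ℝ} (hg : MemLp g 2) :
    inner ℝ (hF.transferFlow s t ρ) (hg.toLp g) = ∫ x, ρ x * g (hF.flow s t x) :=
  HasBoundedCompression.inner_transfer_toLp _ _ _

/-- Regularity of transported densities. -/
theorem exists_hasWeakPartialDeriv_transferFlow (hF : IsTameField F M L L₂) (s : ℝ) {ρ : H0 n}
    {G : Fin n → H0 n} (hG : ∀ j, HasWeakPartialDeriv j ρ (G j)) :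
    ∃ b : ℝ → ℝ, Continuous b ∧ ∀ (k : Fin n) (t : ℝ), ∃ g : H0 n,
      HasWeakPartialDeriv k (hF.transferFlow s t ρ) g ∧ ‖g‖ ≤ b t := by
  refine ⟨fun t => Real.exp (L * |s - t|) ^ n * ∑ j,
    ((L₂ * |s - t| * Real.exp (3 * (L * |s - t|))) * Real.exp (L * |s - t|) * ‖ρ‖
      + Real.exp (L * |s - t|) * ‖G j‖), by fun_prop, fun k t => ?_⟩
  have hL₂ := hF.L₂_nonneg
  have hD : (0:ℝ) ≤ L₂ * |s - t| * Real.exp (3 * (L * |s - t|)) := by positivity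
  obtain ⟨g, hg, hgn⟩ := exists_hasWeakPartialDeriv_transfer (hF.lipschitzWith_flow s t)
    (hF.lipschitzWith_flow t s) (fun x => by rw [flow_flow, flow_self])
    (fun x => by rw [flow_flow, flow_self])
    (D := (L₂ * |s - t| * Real.exp (3 * (L * |s - t|))).toNNReal)
    (fun x y v => by
      rw [Real.coe_toNNReal _ hD]; exact hF.norm_flow_second_difference_le t s x y v)
    (hF.hasBoundedCompression_flow s t) hG k
  refine ⟨g, hg, hgn.trans ?_⟩
  rw [Real.coe_toNNReal _ hD, Real.coe_toNNReal _ (Real.exp_pos _).le,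
    Real.coe_toNNReal _ (Real.exp_pos _).le, abs_sub_comm t s]
  exact mul_le_mul_of_nonneg_right (hF.norm_transferFlow_le s t)
    (Finset.sum_nonneg fun j _ => by positivity)

end IsTameField

/-! ### The forward equation for transported densities. -/

namespace IsTameField

variable {n : ℕ} {F : ℝ → EuclideanSpace ℝ (Fin n) → EuclideanSpace ℝ (Fin n)} {M L L₂ : ℝ}
  {η : EuclideanSpace ℝ (Fin n) → ℝ}

theorem abs_apply_le (hF : IsTameField F M L L₂) (t : ℝ) (i : Fin n)
    (x : EuclideanSpace ℝ (Fin n)) : |F t x i| ≤ M :=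
  (PiLp.norm_apply_le (F t x) i).trans (hF.bound t x)

theorem lipschitzWith_apply (hF : IsTameField F M L L₂) (t : ℝ) (i : Fin n) :
    LipschitzWith L.toNNReal fun x => F t x i :=
  LipschitzWith.of_dist_le_mul fun x y => by
    rw [Real.coe_toNNReal _ hF.L_nonneg, Real.dist_eq, dist_eq_norm]
    exact (PiLp.norm_apply_le (F t x - F t y) i).trans (hF.lip t x y)

theorem memLp_apply_mul (hF : IsTameField F M L L₂) (t : ℝ) (i : Fin n) (v : H0 n) :
    MemLp (fun x => F t x i * v x) 2 :=
  (Lp.memLp v).bounded_mul (hF.lipschitzWith_apply t i).continuous.aestronglyMeasurable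
    (hF.abs_apply_le t i)

theorem memLp_partialDeriv_apply_mul (hF : IsTameField F M L L₂) (t : ℝ) (i : Fin n) (v : H0 n) :
    MemLp (fun x => partialDeriv i (fun x => F t x i) x * v x) 2 :=
  (Lp.memLp v).bounded_mul
    (aestronglyMeasurable_partialDeriv (hF.lipschitzWith_apply t i).continuous i)
    (abs_partialDeriv_le_of_lipschitz (hF.lipschitzWith_apply t i) i)

theorem exists_isAdjointApply (hF : IsTameField F M L L₂) (t : ℝ) {v : H0 n} {g : Fin n → H0 n}
    (hg : ∀ i, HasWeakPartialDeriv i v (g i)) :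
    ∃ w : H0 n, IsAdjointApply (fun x t => F t x) t v w ∧ ‖w‖ ≤ ∑ i, (L * ‖v‖ + M * ‖g i‖) := by
  set N : Fin n → H0 n := fun i => (hF.memLp_partialDeriv_apply_mul t i v).toLp _
    + (hF.memLp_apply_mul t i (g i)).toLp _ with hN
  refine ⟨-∑ i, N i, ⟨N, fun i => ?_, rfl⟩, ?_⟩
  · refine ((hg i).lipschitz_mul (Lp.memLp v) (Lp.memLp (g i)) (hF.lipschitzWith_apply t i)
      (hF.abs_apply_le t i)).congr (Eventually.of_forall fun _ => rfl) ?_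
    filter_upwards [Lp.coeFn_add ((hF.memLp_partialDeriv_apply_mul t i v).toLp _)
      ((hF.memLp_apply_mul t i (g i)).toLp _), (hF.memLp_partialDeriv_apply_mul t i v).coeFn_toLp,
      (hF.memLp_apply_mul t i (g i)).coeFn_toLp] with x h1 h2 h3
    rw [h1, Pi.add_apply, h2, h3]
  · rw [norm_neg]
    refine (norm_sum_le _ _).trans (Finset.sum_le_sum fun i _ => ?_)
    refine (norm_add_le _ _).trans (add_le_add ?_ ?_)
    · refine Lp.norm_le_mul_norm_of_ae_le_mul ?_
      filter_upwards [(hF.memLp_partialDeriv_apply_mul t i v).coeFn_toLp] with x hx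
      rw [hx, norm_mul]
      refine mul_le_mul_of_nonneg_right ?_ (norm_nonneg _)
      exact (abs_partialDeriv_le_of_lipschitz (hF.lipschitzWith_apply t i) i x).trans_eq
        (Real.coe_toNNReal _ hF.L_nonneg)
    · refine Lp.norm_le_mul_norm_of_ae_le_mul ?_
      filter_upwards [(hF.memLp_apply_mul t i (g i)).coeFn_toLp] with x hx
      rw [hx, norm_mul]
      exact mul_le_mul_of_nonneg_right (hF.abs_apply_le t i x) (norm_nonneg _)

theorem memLp_fderiv_apply (hF : IsTameField F M L L₂) (hη : IsTestFunction η) (t : ℝ) :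
    MemLp (fun x => fderiv ℝ η x (F t x)) 2 := by
  simp only [hη.fderiv_apply_eq_sum]
  exact memLp_finsetSum _ fun i _ => (hη.partialDeriv i).memLp.bounded_mul
    (hF.lipschitzWith_apply t i).continuous.aestronglyMeasurable (hF.abs_apply_le t i)

theorem inner_isAdjointApply (hF : IsTameField F M L L₂) {t : ℝ} {v w : H0 n}
    (hw : IsAdjointApply (fun x t => F t x) t v w) (hη : IsTestFunction η) :
    inner ℝ w (hη.memLp.toLp η) = ∫ x, v x * fderiv ℝ η x (F t x) := by
  obtain ⟨N, hN, rfl⟩ := hw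
  have e : ∫ x, v x * fderiv ℝ η x (F t x)
      = ∑ i, ∫ x, (F t x i * v x) * partialDeriv i η x := by
    rw [← integral_finsetSum _ fun i _ =>
      (hF.memLp_apply_mul t i v).integrable_mul_two (hη.partialDeriv i).memLp]
    congr 1; ext x
    rw [hη.fderiv_apply_eq_sum, Finset.mul_sum]
    exact Finset.sum_congr rfl fun i _ => by ring
  rw [e, inner_neg_left, sum_inner, ← Finset.sum_neg_distrib]
  refine Finset.sum_congr rfl fun i _ => ?_
  rw [H0.inner_toLp_right, (hN i).eq_neg hη]

theorem measurable_inner_transferFlow (hF : IsTameField F M L L₂) (s : ℝ) (ρ : H0 n)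
    (hη : IsTestFunction η) :
    Measurable fun t => inner ℝ (hF.transferFlow s t ρ) (hη.memLp.toLp η) := by
  simp only [inner_transferFlow_toLp]
  refine (StronglyMeasurable.integral_prod_right (f := fun t x => ρ x * η (hF.flow s t x))
    ?_).measurable
  exact ((Lp.stronglyMeasurable ρ).comp_measurable measurable_snd).mul
    (hη.contDiff.continuous.comp (hF.continuous_uncurry_flow s)).stronglyMeasurable

theorem stronglyMeasurable_mul_fderiv_flow (hF : IsTameField F M L L₂) (s : ℝ) (ρ : H0 n)
    (hη : IsTestFunction η) :
    StronglyMeasurable (Function.uncurry fun (t : ℝ) (x : EuclideanSpace ℝ (Fin n)) =>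
      ρ x * fderiv ℝ η (hF.flow s t x) (F t (hF.flow s t x))) :=
  ((Lp.stronglyMeasurable ρ).comp_measurable measurable_snd).mul
    (hF.measurable_fderiv_apply_flow hη s).stronglyMeasurable

theorem integrable_mul_fderiv_flow (hF : IsTameField F M L L₂) (s t : ℝ) (ρ : H0 n)
    (hη : IsTestFunction η) :
    Integrable (Function.uncurry fun (t : ℝ) (x : EuclideanSpace ℝ (Fin n)) =>
      ρ x * fderiv ℝ η (hF.flow s t x) (F t (hF.flow s t x)))
      ((volume.restrict (uIoc s t)).prod volume) := by
  obtain ⟨C, hC0, hC⟩ := hη.exists_abs_fderiv_apply_le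
  have hfin : IsFiniteMeasure ((volume : Measure ℝ).restrict (uIoc s t)) := ⟨by simp [uIoc]⟩
  -- Finite propagation speed: a trajectory starting outside `K` cannot reach the support of `η` by
  -- time `t`. The integrand is thus dominated by `|ρ|` times an indicator of a compact set.
  set K := Metric.cthickening (M * |t - s|) (tsupport η) with hK
  have hKc : IsCompact K := IsCompact.cthickening hη.hasCompactSupport
  have hb : MemLp (K.indicator fun _ => C * M) 2
      (volume : Measure (EuclideanSpace ℝ (Fin n))) :=
    memLp_indicator_const _ hKc.measurableSet _ (Or.inr hKc.measure_lt_top.ne)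
  have hbi := (Lp.memLp ρ).norm.integrable_mul_two hb
  refine (hbi.comp_snd (volume.restrict (uIoc s t))).mono'
    (hF.stronglyMeasurable_mul_fderiv_flow s ρ hη).aestronglyMeasurable ?_
  filter_upwards [Measure.quasiMeasurePreserving_fst.ae
    (ae_restrict_mem (μ := (volume : Measure ℝ)) (s := uIoc s t) measurableSet_uIoc)] with z hz
  simp only [Function.uncurry, norm_mul]
  refine mul_le_mul_of_nonneg_left ?_ (norm_nonneg _)
  by_cases hx : z.2 ∈ K
  · rw [indicator_of_mem hx]
    exact (hC _ _).trans (mul_le_mul_of_nonneg_left (hF.bound _ _) hC0)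
  · rw [indicator_of_notMem hx]
    have h0 : hF.flow s z.1 z.2 ∉ tsupport η := by
      contrapose! hx
      refine Metric.mem_cthickening_of_dist_le _ _ _ _ hx ?_
      rw [dist_comm, dist_eq_norm]
      exact (hF.norm_flow_sub_self_le s z.1 z.2).trans (mul_le_mul_of_nonneg_left
        (abs_sub_left_of_mem_uIcc (uIoc_subset_uIcc hz)) hF.M_nonneg)
    rw [hη.fderiv_apply_eq_sum]
    simp [partialDeriv_eq_zero_of_notMem_tsupport h0]

/-- The weak forward equation, valid for every `ρ` in `L₂`: integrate `test_flow_eq` against `ρ`,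
exchange the integrals, and move the flow back onto the density by adjointness. -/
theorem inner_transferFlow_eq_add (hF : IsTameField F M L L₂) (s t : ℝ) (ρ : H0 n)
    (hη : IsTestFunction η) :
    inner ℝ (hF.transferFlow s t ρ) (hη.memLp.toLp η) = inner ℝ ρ (hη.memLp.toLp η)
      + ∫ r in s..t, ∫ x, hF.transferFlow s r ρ x * fderiv ℝ η x (F r x) := by
  have h1 : ∀ r, ∫ x, hF.transferFlow s r ρ x * fderiv ℝ η x (F r x)
      = ∫ x, ρ x * fderiv ℝ η (hF.flow s r x) (F r (hF.flow s r x)) := fun r => by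
    rw [← H0.inner_toLp_right _ (hF.memLp_fderiv_apply hη r), inner_transferFlow_toLp]
  simp only [h1]
  have hint := hF.integrable_mul_fderiv_flow s t ρ hη
  rw [intervalIntegral_integral_swap hint, inner_transferFlow_toLp, H0.inner_toLp_right]
  have hi2 : Integrable (fun x => ρ x * η (hF.flow s t x)) :=
    (Lp.memLp ρ).integrable_mul_two ((hF.hasBoundedCompression_flow s t).memLp_comp hη.memLp)
  have hi1 := (Lp.memLp ρ).integrable_mul_two hη.memLp
  have e : ∀ x, ∫ r in s..t, ρ x * fderiv ℝ η (hF.flow s r x) (F r (hF.flow s r x))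
      = ρ x * η (hF.flow s t x) - ρ x * η x := fun x => by
    rw [intervalIntegral.integral_const_mul, hF.test_flow_eq hη s t x]
    ring
  simp only [e]
  rw [integral_sub hi2 hi1]
  ring

/-- The transported density of a function of class `W₂¹` solves the forward equation. -/
theorem exists_forward_equation (hF : IsTameField F M L L₂) (s : ℝ) {ρ : H0 n} (hρ : MemH1 ρ) :
    ∃ (g : Fin n → ℝ → H0 n) (q : ℝ → H0 n) (b : ℝ → ℝ), Continuous b ∧
      (∀ i t, HasWeakPartialDeriv i (hF.transferFlow s t ρ) (g i t)) ∧
      (∀ i t, ‖g i t‖ ≤ b t) ∧ (∀ i, StronglyMeasurable (g i)) ∧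
      (∀ t, IsAdjointApply (fun x t => F t x) t (hF.transferFlow s t ρ) (q t)) ∧
      (∀ t, ‖q t‖ ≤ b t) ∧ StronglyMeasurable q ∧
      ∀ t, hF.transferFlow s t ρ = ρ + ∫ r in s..t, q r := by
  obtain ⟨G, hG⟩ := hρ
  obtain ⟨b, hb, hg⟩ := hF.exists_hasWeakPartialDeriv_transferFlow s hG
  choose g hgw hgb using hg
  choose q hq hqb using fun t => hF.exists_isAdjointApply t (fun i => hgw i t)
  have hL := hF.L_nonneg
  have hM := hF.M_nonneg
  set b' : ℝ → ℝ := fun t => ∑ _i : Fin n, (L * (Real.exp (L * |s - t|) ^ n * ‖ρ‖) + M * |b t|)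
    with hb'
  have hb'c : Continuous b' := by fun_prop
  have hqb' : ∀ t, ‖q t‖ ≤ b' t := fun t => by
    refine (hqb t).trans (Finset.sum_le_sum fun i _ => add_le_add ?_ ?_)
    · exact mul_le_mul_of_nonneg_left (((hF.transferFlow s t).le_opNorm _).trans
        (mul_le_mul_of_nonneg_right (hF.norm_transferFlow_le s t) (norm_nonneg _))) hL
    · exact mul_le_mul_of_nonneg_left ((hgb i t).trans (le_abs_self _)) hM
  have hb'0 : ∀ t, 0 ≤ b' t := fun t => (norm_nonneg _).trans (hqb' t)
  -- `q` and `g` were chosen separately for each `t`; their pairings with test functions do not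
  -- depend on the choices and are measurable in `t`, which suffices.
  have hqm : StronglyMeasurable q := H0.stronglyMeasurable_of_test fun η hη => by
    have e : ∀ t, inner ℝ (q t) (hη.memLp.toLp η)
        = ∫ x, ρ x * fderiv ℝ η (hF.flow s t x) (F t (hF.flow s t x)) := fun t => by
      rw [hF.inner_isAdjointApply (hq t) hη, ← H0.inner_toLp_right _ (hF.memLp_fderiv_apply hη t),
        inner_transferFlow_toLp]
    simp only [e]
    exact (StronglyMeasurable.integral_prod_right
      (hF.stronglyMeasurable_mul_fderiv_flow s ρ hη)).measurable
  have hgm : ∀ i, StronglyMeasurable (g i) := fun i =>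
    H0.stronglyMeasurable_of_test fun η hη => by
      have e : ∀ t, inner ℝ (g i t) (hη.memLp.toLp η)
          = -inner ℝ (hF.transferFlow s t ρ) ((hη.partialDeriv i).memLp.toLp _) := fun t => by
        rw [H0.inner_toLp_right, H0.inner_toLp_right, (hgw i t).eq_neg hη, neg_neg]
      simp only [e]
      exact (hF.measurable_inner_transferFlow s ρ (hη.partialDeriv i)).neg
  refine ⟨g, q, fun t => |b t| + b' t, by fun_prop, hgw, fun i t => ?_, hgm, hq, fun t => ?_,
    hqm, fun t => ?_⟩
  · exact (hgb i t).trans ((le_abs_self _).trans (le_add_of_nonneg_right (hb'0 t)))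
  · exact (hqb' t).trans (le_add_of_nonneg_left (abs_nonneg _))
  · have hqi : IntervalIntegrable q volume s t :=
      (hb'c.intervalIntegrable s t).mono_fun hqm.aestronglyMeasurable
        (Eventually.of_forall fun r => (hqb' r).trans (le_abs_self _))
    apply H0.ext_test
    intro η hη
    have h2 : inner ℝ (∫ r in s..t, q r) (hη.memLp.toLp η)
        = ∫ r in s..t, inner ℝ (q r) (hη.memLp.toLp η) := by
      have := (innerSL ℝ (hη.memLp.toLp η)).intervalIntegral_comp_comm hqi
      simpa only [innerSL_apply_apply, real_inner_comm] using this.symm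
    rw [inner_add_left, h2, hF.inner_transferFlow_eq_add s t ρ hη]
    congr 1
    refine intervalIntegral.integral_congr fun r _ => ?_
    exact (hF.inner_isAdjointApply (hq r) hη).symm

theorem _root_.memH1_of_mem_testSubmodule {u : H0 n} (hu : u ∈ testSubmodule n) : MemH1 u := by
  obtain ⟨η, hη, rfl⟩ := hu
  obtain ⟨C, hC⟩ := hη.exists_lipschitzWith
  exact ⟨fun i => (hη.partialDeriv i).memLp.toLp _, fun i =>
    (hasWeakPartialDeriv_of_lipschitz hC i).congr hη.memLp.coeFn_toLp.symm
      (hη.partialDeriv i).memLp.coeFn_toLp.symm⟩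

theorem continuous_transferFlow_of_memH1 (hF : IsTameField F M L L₂) (s : ℝ) {ρ : H0 n}
    (hρ : MemH1 ρ) : Continuous fun t => hF.transferFlow s t ρ := by
  obtain ⟨g, q, b, hb, -, -, -, -, hqb, hqm, hp⟩ := hF.exists_forward_equation s hρ
  simp only [hp]
  refine continuous_const.add (intervalIntegral.continuous_primitive (fun a c => ?_) s)
  exact (hb.intervalIntegrable a c).mono_fun hqm.aestronglyMeasurable
    (Eventually.of_forall fun r => (hqb r).trans (le_abs_self _))

/-- The operators are bounded locally uniformly in time, so the curve is a locally uniform limit of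
the continuous curves issuing from test functions. -/
theorem continuous_transferFlow (hF : IsTameField F M L L₂) (s : ℝ) (ρ : H0 n) :
    Continuous fun t => hF.transferFlow s t ρ := by
  refine continuous_of_locally_uniform_approx_of_continuousAt fun t U hU => ?_
  obtain ⟨ε, hε, hεU⟩ := Metric.mem_uniformity_dist.1 hU
  set c : ℝ → ℝ := fun t => Real.exp (L * |s - t|) ^ n with hc
  have hcc : Continuous c := by fun_prop
  have hc0 : 0 < c t := by positivity
  -- `c t + 1` bounds the operator norm at all times near `t`.
  obtain ⟨ρ', hρ'm, hρ'⟩ := Metric.dense_iff.1 (dense_testSubmodule n) ρ (ε / (c t + 1))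
    (by positivity)
  refine ⟨{r | c r < c t + 1}, (isOpen_lt hcc continuous_const).mem_nhds (by simp),
    fun t => hF.transferFlow s t ρ',
    hF.continuous_transferFlow_of_memH1 s (memH1_of_mem_testSubmodule hρ')
      |>.continuousAt, fun r hr => hεU ?_⟩
  rw [Metric.mem_ball, dist_comm, lt_div_iff₀ (by positivity)] at hρ'm
  rw [dist_eq_norm, ← map_sub]
  refine ((hF.transferFlow s r).le_opNorm _).trans_lt (lt_of_le_of_lt ?_ hρ'm)
  rw [mul_comm, dist_eq_norm]
  exact mul_le_mul_of_nonneg_left ((hF.norm_transferFlow_le s r).trans hr.le) (norm_nonneg _)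

/-- The forward operator: `ρ` is sent to the curve of transported densities. -/
def forwardOperator (hF : IsTameField F M L L₂) (s T : ℝ) : H0 n →L[ℝ] C(Icc s T, H0 n) :=
  LinearMap.mkContinuous
    { toFun := fun ρ => ⟨fun t => hF.transferFlow s t ρ,
        (hF.continuous_transferFlow s ρ).comp continuous_subtype_val⟩
      map_add' := fun ρ ρ' => by ext1 t; exact map_add (hF.transferFlow s t) ρ ρ'
      map_smul' := fun c ρ => by ext1 t; exact map_smul (hF.transferFlow s t) c ρ }
    (Real.exp (L * |s - T|) ^ n) fun ρ => by
      rw [ContinuousMap.norm_le _ (by positivity)]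
      intro t
      refine ((hF.transferFlow s t).le_opNorm _).trans
        (mul_le_mul_of_nonneg_right ((hF.norm_transferFlow_le s t).trans ?_) (norm_nonneg _))
      refine pow_le_pow_left₀ (Real.exp_pos _).le (Real.exp_le_exp.2
        (mul_le_mul_of_nonneg_left ?_ hF.L_nonneg)) n
      rw [abs_sub_comm s t, abs_sub_comm s T, abs_of_nonneg (sub_nonneg.2 t.2.1),
        abs_of_nonneg (sub_nonneg.2 (t.2.1.trans t.2.2))]
      linarith [t.2.2]

theorem forwardOperator_apply (hF : IsTameField F M L L₂) (s T : ℝ) (ρ : H0 n) (t : Icc s T) :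
    hF.forwardOperator s T ρ t = hF.transferFlow s t ρ := rfl

theorem isForwardSolution_forwardOperator (hF : IsTameField F M L L₂) {s T : ℝ} (hsT : s ≤ T)
    {f : EuclideanSpace ℝ (Fin n) → ℝ → EuclideanSpace ℝ (Fin n)}
    (hf : ∀ᵐ t ∂(volume.restrict (Icc s T)), ∀ x, f x t = F t x) {ρ : H0 n} (hρ : MemH1 ρ) :
    IsForwardSolution f hsT ρ (hF.forwardOperator s T ρ) := by
  obtain ⟨g, q, b, hb, hgw, hgb, hgm, hq, hqb, hqm, hp⟩ := hF.exists_forward_equation s hρ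
  obtain ⟨B, hB⟩ := isCompact_Icc.exists_bound_of_continuousOn (s := Icc s T) hb.continuousOn
  have hext : ∀ t ∈ Icc s T, IccExtend hsT (hF.forwardOperator s T ρ) t = hF.transferFlow s t ρ :=
    fun t ht => by rw [IccExtend_of_mem _ _ ht]; rfl
  have hmem : ∀ u : ℝ → H0 n, StronglyMeasurable u → (∀ t, ‖u t‖ ≤ b t) →
      MemLp u 2 (volume.restrict (Icc s T)) := fun u hu hub =>
    MemLp.of_bound hu.aestronglyMeasurable B (by
      filter_upwards [ae_restrict_mem measurableSet_Icc] with t ht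
      exact (hub t).trans ((le_abs_self _).trans (hB t ht)))
  refine ⟨⟨?_, g, fun i => ⟨hmem _ (hgm i) (hgb i), ?_⟩⟩, q, hmem q hqm hqb, ?_, fun t => hp t⟩
  · have hc : Continuous (IccExtend hsT (hF.forwardOperator s T ρ)) :=
      (map_continuous (hF.forwardOperator s T ρ)).Icc_extend'
    refine MemLp.of_bound hc.aestronglyMeasurable ‖hF.forwardOperator s T ρ‖
      (Eventually.of_forall fun t => ?_)
    exact (hF.forwardOperator s T ρ).norm_coe_le_norm _
  · filter_upwards [ae_restrict_mem measurableSet_Icc] with t ht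
    rw [hext t ht]
    exact hgw i t
  · filter_upwards [ae_restrict_mem measurableSet_Icc, hf] with t ht hft
    rw [hext t ht]
    obtain ⟨N, hN, hqN⟩ := hq t
    exact ⟨N, fun i => by simpa only [hft] using hN i, hqN⟩

end IsTameField

/-! ### The energy identity for curves with square-integrable velocity. -/

/-- Continuity of `Ψ` makes the increments of `G` of order `o(|b - a|)`, so `G` has zero derivative.
-/
theorem eq_of_abs_sub_le_mul_sub {G Ψ : ℝ → ℝ} {s T : ℝ} (hΨ : ContinuousOn Ψ (Icc s T))
    (h : ∀ a ∈ Icc s T, ∀ b ∈ Icc s T, a ≤ b → |G b - G a| ≤ (b - a) * (Ψ b - Ψ a)) :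
    ∀ t ∈ Icc s T, G t = G s := by
  have h' : ∀ a ∈ Icc s T, ∀ b ∈ Icc s T, |G b - G a| ≤ |b - a| * |Ψ b - Ψ a| := by
    intro a ha b hb
    rw [← abs_mul]
    rcases le_total a b with hab | hab
    · exact (h a ha b hb hab).trans (le_abs_self _)
    · rw [abs_sub_comm (G b)]
      refine (h b hb a ha hab).trans ((le_abs_self _).trans_eq ?_)
      congr 1; ring
  have hd : ∀ t ∈ Icc s T, HasDerivWithinAt G 0 (Icc s T) t := fun t ht => by
    rw [hasDerivWithinAt_iff_isLittleO, Asymptotics.isLittleO_iff]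
    intro c hc
    have h1 := Metric.tendsto_nhds.1 (hΨ t ht) c hc
    filter_upwards [h1, self_mem_nhdsWithin] with x hx hxm
    rw [smul_zero, sub_zero, mul_comm, Real.norm_eq_abs, Real.norm_eq_abs]
    rw [Real.dist_eq] at hx
    exact (h' t ht x hxm).trans (mul_le_mul_of_nonneg_left hx.le (abs_nonneg _))
  refine constant_of_derivWithin_zero (fun t ht => (hd t ht).differentiableWithinAt)
    fun t ht => ?_
  exact (hd t ⟨ht.1, ht.2.le⟩).derivWithin
    (uniqueDiffOn_Icc (ht.1.trans_lt ht.2) t ⟨ht.1, ht.2.le⟩)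

/-- The variance of `u` about its mean `c` is nonnegative. -/
theorem sq_integral_le {u : ℝ → ℝ} {a b : ℝ} (hab : a ≤ b) (hu : IntervalIntegrable u volume a b)
    (hu2 : IntervalIntegrable (fun r => u r ^ 2) volume a b) :
    (∫ r in a..b, u r) ^ 2 ≤ (b - a) * ∫ r in a..b, u r ^ 2 := by
  rcases hab.eq_or_lt with rfl | hab'
  · simp
  set J := ∫ r in a..b, u r
  set c := J / (b - a) with hc
  have h0 : 0 ≤ ∫ r in a..b, (u r - c) ^ 2 :=
    intervalIntegral.integral_nonneg hab fun r _ => sq_nonneg _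
  have e : ∫ r in a..b, (u r - c) ^ 2 = (∫ r in a..b, u r ^ 2) - 2 * c * J + (b - a) * c ^ 2 := by
    have : ∀ r, (u r - c) ^ 2 = u r ^ 2 - 2 * c * u r + c ^ 2 := fun r => by ring
    simp only [this]
    rw [intervalIntegral.integral_add (hu2.sub (hu.const_mul _)) (by simp),
      intervalIntegral.integral_sub hu2 (hu.const_mul _), intervalIntegral.integral_const_mul,
      intervalIntegral.integral_const, smul_eq_mul]
  rw [e] at h0
  have hpos : 0 < b - a := sub_pos.2 hab'
  have hcJ : (b - a) * c = J := by rw [hc]; field_simp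
  nlinarith [mul_nonneg hpos.le h0]

section NormSq

variable {H : Type*} [NormedAddCommGroup H] [InnerProductSpace ℝ H] [CompleteSpace H]

/-- Expanding `‖p b‖²` about `p a` leaves errors of size `(∫ ‖q‖)²` over `[a, b]`, which
Cauchy–Schwarz bounds by `(b - a) ∫ ‖q‖²`; the difference of the two sides is then constant by
`eq_of_abs_sub_le_mul_sub`. -/
theorem norm_sq_eq_integral_inner {p q : ℝ → H} {s T : ℝ} (hp : Continuous p)
    (hq : MemLp q 2 (volume.restrict (Icc s T)))
    (hpq : ∀ t ∈ Icc s T, p t = ∫ r in s..t, q r) :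
    ∀ t ∈ Icc s T, ‖p t‖ ^ 2 = ∫ r in s..t, 2 * inner ℝ (q r) (p r) := by
  intro t ht
  have hsT := ht.1.trans ht.2
  have hqi : IntegrableOn q (Icc s T) := hq.integrable (by norm_num)
  have hq2 : IntegrableOn (fun r => ‖q r‖ ^ 2) (Icc s T) := hq.norm.integrable_sq
  have hsub : ∀ a ∈ Icc s T, ∀ b ∈ Icc s T, uIoc a b ⊆ Icc s T := fun a ha b hb =>
    uIoc_subset_uIcc.trans (OrdConnected.uIcc_subset ordConnected_Icc ha hb)
  have hqI : ∀ a ∈ Icc s T, ∀ b ∈ Icc s T, IntervalIntegrable q volume a b := fun a ha b hb =>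
    intervalIntegrable_iff.2 (hqi.mono_set (hsub a ha b hb))
  have hq2I : ∀ a ∈ Icc s T, ∀ b ∈ Icc s T, IntervalIntegrable (fun r => ‖q r‖ ^ 2) volume a b :=
    fun a ha b hb => intervalIntegrable_iff.2 (hq2.mono_set (hsub a ha b hb))
  have hinn : ∀ u : ℝ → H, Continuous u → ∀ a ∈ Icc s T, ∀ b ∈ Icc s T,
      IntervalIntegrable (fun r => inner ℝ (q r) (u r)) volume a b := by
    intro u hu a ha b hb
    obtain ⟨B, hB⟩ := isCompact_Icc.exists_bound_of_continuousOn (s := Icc s T) hu.continuousOn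
    have hqab := hqI a ha b hb
    refine (hqab.norm.const_mul B).mono_fun'
      ((intervalIntegrable_iff.1 hqab).aestronglyMeasurable.inner hu.aestronglyMeasurable) ?_
    filter_upwards [ae_restrict_mem measurableSet_uIoc] with r hr
    refine (norm_inner_le_norm _ _).trans ?_
    rw [mul_comm]
    exact mul_le_mul_of_nonneg_right (hB r (hsub a ha b hb hr)) (norm_nonneg _)
  have hs : s ∈ Icc s T := left_mem_Icc.2 hsT
  set G : ℝ → ℝ := fun t => ‖p t‖ ^ 2 - ∫ r in s..t, 2 * inner ℝ (q r) (p r) with hG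
  -- Of the factor `3`, two parts pay for replacing `p r` by `p a` under the integral and one for
  -- `‖p b - p a‖²`.
  set Ψ : ℝ → ℝ := fun t => 3 * ∫ r in s..t, ‖q r‖ ^ 2 with hΨ
  have hΨc : ContinuousOn Ψ (Icc s T) := by
    have := intervalIntegral.continuousOn_primitive_interval' (a := s)
      (hq2I s hs T (right_mem_Icc.2 hsT)) left_mem_uIcc
    rw [uIcc_of_le hsT] at this
    exact this.const_mul 3
  have key := eq_of_abs_sub_le_mul_sub (G := G) hΨc fun a ha b hb hab => ?_
  · have h1 := key t ht
    have h2 : p s = 0 := by rw [hpq s hs, intervalIntegral.integral_same]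
    simp only [hG, intervalIntegral.integral_same, h2] at h1
    simpa [sub_eq_zero] using h1
  · set J := ∫ r in a..b, ‖q r‖ with hJ
    have hJ0 : 0 ≤ J := intervalIntegral.integral_nonneg hab fun _ _ => norm_nonneg _
    have hdiff : ∀ r ∈ Icc a b, p r - p a = ∫ u in a..r, q u := fun r hr => by
      have hr' : r ∈ Icc s T := ⟨ha.1.trans hr.1, hr.2.trans hb.2⟩
      rw [hpq r hr', hpq a ha, intervalIntegral.integral_interval_sub_left (hqI s hs r hr')
        (hqI s hs a ha)]
    have hJr : ∀ r ∈ Icc a b, ‖p r - p a‖ ≤ J := fun r hr => by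
      rw [hdiff r hr]
      refine (intervalIntegral.norm_integral_le_integral_norm hr.1).trans ?_
      exact intervalIntegral.integral_mono_interval le_rfl hr.1 hr.2
        (Eventually.of_forall fun _ => norm_nonneg _) (hqI a ha b hb).norm
    have hab' : b ∈ Icc a b := right_mem_Icc.2 hab
    have h1 : (∫ r in s..b, 2 * inner ℝ (q r) (p r)) - ∫ r in s..a, 2 * inner ℝ (q r) (p r)
        = 2 * ∫ r in a..b, inner ℝ (q r) (p r) := by
      rw [intervalIntegral.integral_interval_sub_left ((hinn p hp s hs b hb).const_mul 2)
        ((hinn p hp s hs a ha).const_mul 2), intervalIntegral.integral_const_mul]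
    have h2 : inner ℝ (p b - p a) (p a) = ∫ r in a..b, inner ℝ (q r) (p a) := by
      rw [hdiff b hab']
      have := (innerSL ℝ (p a)).intervalIntegral_comp_comm (hqI a ha b hb)
      simp only [innerSL_apply_apply] at this
      rw [real_inner_comm, ← this]
      simp only [real_inner_comm]
    have h3 : ‖p b‖ ^ 2 - ‖p a‖ ^ 2 = 2 * inner ℝ (p b - p a) (p a) + ‖p b - p a‖ ^ 2 := by
      have := norm_add_sq_real (p a) (p b - p a)
      rw [add_sub_cancel, real_inner_comm] at this
      linarith
    have h4 : |∫ r in a..b, (inner ℝ (q r) (p a) - inner ℝ (q r) (p r))| ≤ J ^ 2 := by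
      rw [← Real.norm_eq_abs]
      refine (intervalIntegral.norm_integral_le_of_norm_le hab (g := fun r => J * ‖q r‖) ?_
        ((hqI a ha b hb).norm.const_mul J)).trans_eq ?_
      · refine Eventually.of_forall fun r hr => ?_
        rw [← inner_sub_right, mul_comm]
        refine (norm_inner_le_norm _ _).trans (mul_le_mul_of_nonneg_left ?_ (norm_nonneg _))
        rw [norm_sub_rev]
        exact hJr r ⟨hr.1.le, hr.2⟩
      · rw [intervalIntegral.integral_const_mul, pow_two]
    rw [intervalIntegral.integral_sub (hinn _ continuous_const a ha b hb) (hinn p hp a ha b hb),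
      ← h2] at h4
    have h5 : ‖p b - p a‖ ^ 2 ≤ J ^ 2 := pow_le_pow_left₀ (norm_nonneg _) (hJr b hab') 2
    have h6 := sq_integral_le hab (hqI a ha b hb).norm (hq2I a ha b hb)
    have h7 : Ψ b - Ψ a = 3 * ∫ r in a..b, ‖q r‖ ^ 2 := by
      simp only [hΨ]
      rw [← mul_sub, intervalIntegral.integral_interval_sub_left (hq2I s hs b hb)
        (hq2I s hs a ha)]
    rw [h7]
    have h8 : G b - G a = 2 * (inner ℝ (p b - p a) (p a) - ∫ r in a..b, inner ℝ (q r) (p r))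
        + ‖p b - p a‖ ^ 2 := by
      simp only [hG]; linarith
    rw [h8]
    refine (abs_add_le _ _).trans ?_
    rw [abs_mul, abs_two, abs_of_nonneg (sq_nonneg ‖p b - p a‖)]
    nlinarith

end NormSq

/-! ### Energy estimate and uniqueness for the forward equation. -/

namespace IsTameField

variable {n : ℕ} {F : ℝ → EuclideanSpace ℝ (Fin n) → EuclideanSpace ℝ (Fin n)} {M L L₂ : ℝ}

/-- The energy estimate for the adjoint generator. -/
theorem two_mul_inner_isAdjointApply_le (hF : IsTameField F M L L₂) {t : ℝ} {v w : H0 n}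
    (hv : MemH1 v) (hw : IsAdjointApply (fun x t => F t x) t v w) :
    2 * inner ℝ w v ≤ n * L * ‖v‖ ^ 2 := by
  obtain ⟨g, hg⟩ := hv
  obtain ⟨N, hN, rfl⟩ := hw
  -- With `N i = (∂ᵢ Fᵢ) v + Fᵢ ∂ᵢ v`, integration by parts turns `∫ Fᵢ v ∂ᵢ v` into `-∫ N i v`;
  -- hence `2 ∫ N i v = ∫ (∂ᵢ Fᵢ) v²`, free of derivatives of `v`.
  have hterm : ∀ i, -(2 * inner ℝ (N i) v) ≤ L * ‖v‖ ^ 2 := fun i => by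
    have hFv := hF.memLp_apply_mul t i v
    have hdFv := hF.memLp_partialDeriv_apply_mul t i v
    have hFg := hF.memLp_apply_mul t i (g i)
    have hae := (hN i).ae_unique (Lp.memLp (N i)) (hdFv.add hFg)
      ((hg i).lipschitz_mul (Lp.memLp v) (Lp.memLp (g i)) (hF.lipschitzWith_apply t i)
        (hF.abs_apply_le t i))
    have h1 := (hN i).integral_mul_eq_neg hFv (Lp.memLp (N i)) (Lp.memLp v) (Lp.memLp (g i)) (hg i)
    have h2 : ∫ x, N i x * v x = (∫ x, partialDeriv i (fun x => F t x i) x * v x * v x)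
        + ∫ x, F t x i * v x * g i x := by
      have hFgv : Integrable fun x => F t x i * v x * g i x :=
        hFv.integrable_mul_two (Lp.memLp (g i))
      rw [← integral_add (hdFv.integrable_mul_two (Lp.memLp v)) hFgv]
      refine integral_congr_ae ?_
      filter_upwards [hae] with x hx
      rw [hx, Pi.add_apply]; ring
    have h3 : |∫ x, partialDeriv i (fun x => F t x i) x * v x * v x| ≤ L * ‖v‖ ^ 2 := by
      rw [← H0.inner_toLp_left v hdFv]
      refine (abs_real_inner_le_norm _ _).trans ?_
      rw [pow_two, ← mul_assoc]
      refine mul_le_mul_of_nonneg_right ?_ (norm_nonneg _)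
      refine Lp.norm_le_mul_norm_of_ae_le_mul ?_
      filter_upwards [hdFv.coeFn_toLp] with x hx
      rw [hx, norm_mul]
      refine mul_le_mul_of_nonneg_right ?_ (norm_nonneg _)
      exact (abs_partialDeriv_le_of_lipschitz (hF.lipschitzWith_apply t i) i x).trans_eq
        (Real.coe_toNNReal _ hF.L_nonneg)
    rw [H0.inner_eq]
    linarith [neg_abs_le (∫ x, partialDeriv i (fun x => F t x i) x * v x * v x)]
  rw [inner_neg_left, sum_inner, mul_neg, Finset.mul_sum, ← Finset.sum_neg_distrib]
  refine (Finset.sum_le_sum fun i _ => hterm i).trans_eq ?_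
  simp [mul_assoc]

theorem isAdjointApply_sub (hF : IsTameField F M L L₂) {t : ℝ} {v w v' w' : H0 n}
    (h : IsAdjointApply (fun x t => F t x) t v w) (h' : IsAdjointApply (fun x t => F t x) t v' w') :
    IsAdjointApply (fun x t => F t x) t (v - v') (w - w') := by
  obtain ⟨N, hN, rfl⟩ := h
  obtain ⟨N', hN', rfl⟩ := h'
  refine ⟨fun i => N i - N' i, fun i => ?_, by rw [Finset.sum_sub_distrib]; abel⟩
  refine ((hN i).sub (hF.memLp_apply_mul t i v) (hF.memLp_apply_mul t i v') (Lp.memLp _)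
    (Lp.memLp _) (hN' i)).congr ?_ (Lp.coeFn_sub _ _).symm
  filter_upwards [Lp.coeFn_sub v v'] with x hx
  rw [hx, Pi.sub_apply, Pi.sub_apply]; ring

/-- The difference of two solutions starts at zero and its squared norm is at most `n L` times its
own integral, so Grönwall with `C = 0` makes it vanish. -/
theorem forwardSolution_unique (hF : IsTameField F M L L₂) {s T : ℝ} (hsT : s ≤ T)
    {f : EuclideanSpace ℝ (Fin n) → ℝ → EuclideanSpace ℝ (Fin n)}
    (hf : ∀ᵐ t ∂(volume.restrict (Icc s T)), ∀ x, f x t = F t x) {ρ : H0 n}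
    {p p' : C(Icc s T, H0 n)} (hp : IsForwardSolution f hsT ρ p)
    (hp' : IsForwardSolution f hsT ρ p') : p = p' := by
  obtain ⟨⟨-, g, hg⟩, q, hq, hqa, hpq⟩ := hp
  obtain ⟨⟨-, g', hg'⟩, q', hq', hqa', hpq'⟩ := hp'
  set d : ℝ → H0 n := fun t => IccExtend hsT p t - IccExtend hsT p' t with hd
  have hdc : Continuous d :=
    (map_continuous p).Icc_extend'.sub (map_continuous p').Icc_extend'
  have hI : ∀ u : ℝ → H0 n, MemLp u 2 (volume.restrict (Icc s T)) → ∀ t ∈ Icc s T,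
      IntervalIntegrable u volume s t := fun u hu t ht => by
    have h1 : IntegrableOn u (Icc s T) := hu.integrable (by norm_num)
    rw [intervalIntegrable_iff_integrableOn_Ioc_of_le ht.1]
    exact h1.mono_set (Ioc_subset_Icc_self.trans (Icc_subset_Icc_right ht.2))
  have hdq : ∀ t ∈ Icc s T, d t = ∫ r in s..t, (q - q') r := fun t ht => by
    simp only [hd, Pi.sub_apply]
    rw [IccExtend_of_mem _ _ ht, IccExtend_of_mem _ _ ht, hpq, hpq',
      intervalIntegral.integral_sub (hI q hq t ht) (hI q' hq' t ht)]
    abel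
  have hsq := norm_sq_eq_integral_inner hdc (hq.sub hq') hdq
  have hae : ∀ᵐ r ∂(volume.restrict (Icc s T)),
      2 * inner ℝ ((q - q') r) (d r) ≤ n * L * ‖d r‖ ^ 2 := by
    filter_upwards [hqa, hqa', hf, ae_all_iff.2 fun i => (hg i).2, ae_all_iff.2 fun i => (hg' i).2]
      with r h1 h2 h3 h4 h5
    have h6 : ∀ {v w : H0 n}, IsAdjointApply f r v w → IsAdjointApply (fun x t => F t x) r v w := by
      rintro v w ⟨N, hN, hw⟩
      exact ⟨N, fun i => by simpa only [h3] using hN i, hw⟩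
    refine hF.two_mul_inner_isAdjointApply_le ⟨fun i => g i r - g' i r, fun i => ?_⟩
      (hF.isAdjointApply_sub (h6 h1) (h6 h2))
    exact ((h4 i).sub (Lp.memLp _) (Lp.memLp _) (Lp.memLp _) (Lp.memLp _) (h5 i)).congr
      (Lp.coeFn_sub _ _).symm (Lp.coeFn_sub _ _).symm
  have hzero : ∀ t ∈ Icc s T, ‖d t‖ ^ 2 ≤ 0 := by
    intro t ht
    have := le_mul_exp_of_le_add_integral (φ := fun t => ‖d t‖ ^ 2) (a := s) (b := T) (C := 0)
      (L := n * L) (mul_nonneg (Nat.cast_nonneg _) hF.L_nonneg)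
      (by fun_prop : Continuous fun t => ‖d t‖ ^ 2).continuousOn (fun r hr => ?_) t ht
    · simpa using this
    · rw [zero_add, hsq r hr, ← intervalIntegral.integral_const_mul,
        intervalIntegral.integral_of_le hr.1, intervalIntegral.integral_of_le hr.1]
      have hsub : Ioc s r ⊆ Icc s T := Ioc_subset_Icc_self.trans (Icc_subset_Icc_right hr.2)
      refine integral_mono_ae ?_ ?_ (ae_restrict_of_ae_restrict_of_subset hsub hae)
      · obtain ⟨B, hB⟩ := isCompact_Icc.exists_bound_of_continuousOn (s := Icc s T)
          hdc.continuousOn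
        have hqq : IntegrableOn (q - q') (Ioc s r) :=
          IntegrableOn.mono_set ((hq.sub hq').integrable (by norm_num)) hsub
        refine ((hqq.norm.const_mul B).mono'
          (hqq.aestronglyMeasurable.inner hdc.aestronglyMeasurable) ?_).const_mul 2
        filter_upwards [ae_restrict_mem measurableSet_Ioc] with u hu
        refine (norm_inner_le_norm _ _).trans ?_
        rw [mul_comm]
        exact mul_le_mul_of_nonneg_right (hB u (hsub hu)) (norm_nonneg _)
      · exact (by fun_prop : Continuous fun r => n * L * ‖d r‖ ^ 2).integrableOn_Ioc
  ext1 t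
  have h := hzero t t.2
  have h0 : ‖d t‖ = 0 := by
    have := norm_nonneg (d t)
    nlinarith
  have h1 := sub_eq_zero.1 (norm_eq_zero.1 h0)
  rwa [IccExtend_val, IccExtend_val] at h1

end IsTameField

/-! ### From regular fields to tame fields. -/

section PartialDerivatives

variable {n : ℕ} {u : EuclideanSpace ℝ (Fin n) → ℝ} {K : ℝ}

theorem EuclideanSpace.sum_single_eq (v : EuclideanSpace ℝ (Fin n)) :
    ∑ i, v i • EuclideanSpace.single i (1:ℝ) = v := by
  simpa using (EuclideanSpace.basisFun (Fin n) ℝ).sum_repr v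

theorem EuclideanSpace.norm_le_sum_abs (v : EuclideanSpace ℝ (Fin n)) : ‖v‖ ≤ ∑ i, |v i| := by
  conv_lhs => rw [← EuclideanSpace.sum_single_eq v]
  refine (norm_sum_le _ _).trans (Finset.sum_le_sum fun i _ => ?_)
  rw [norm_smul]
  simp

theorem EuclideanSpace.norm_le_of_forall_abs_le {v : EuclideanSpace ℝ (Fin n)}
    (h : ∀ i, |v i| ≤ K) : ‖v‖ ≤ n * K := by
  refine (EuclideanSpace.norm_le_sum_abs v).trans ((Finset.sum_le_sum fun i _ => h i).trans_eq ?_)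
  simp

theorem abs_sub_le_of_partialDeriv_single {j : Fin n} (hd : HasPartialDeriv j u)
    (hK : ∀ x, |partialDeriv j u x| ≤ K) (x : EuclideanSpace ℝ (Fin n)) (a : ℝ) :
    |u (x + a • EuclideanSpace.single j 1) - u x| ≤ K * |a| := by
  have h1 : ∀ t : ℝ, HasDerivAt (fun t : ℝ => u (x + t • EuclideanSpace.single j 1))
      (partialDeriv j u (x + t • EuclideanSpace.single j 1)) t := fun t => by
    have h2 := (hd (x + t • EuclideanSpace.single j 1)).hasLineDerivAt
    have h3 : HasDerivAt (fun r : ℝ => r - t) 1 t := (hasDerivAt_id t).sub_const t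
    have h4 := HasDerivAt.comp (h₂ := fun r : ℝ =>
      u (x + t • EuclideanSpace.single j 1 + r • EuclideanSpace.single j 1)) t
      (by rw [sub_self]; exact h2) h3
    rw [mul_one] at h4
    refine h4.congr_of_eventuallyEq (Eventually.of_forall fun r => ?_)
    simp only [Function.comp, add_assoc, ← add_smul, add_sub_cancel]
  have := convex_univ.norm_image_sub_le_of_norm_hasDerivWithin_le (C := K)
    (fun t _ => (h1 t).hasDerivWithinAt) (fun t _ => hK _) (mem_univ (0:ℝ)) (mem_univ a)
  simpa using this

/-- Changing one coordinate at a time uses only the mean value inequality on lines; bounded partial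
derivatives suffice, without total differentiability. -/
theorem abs_sub_le_of_partialDeriv (hd : ∀ j, HasPartialDeriv j u)
    (hK : ∀ j x, |partialDeriv j u x| ≤ K) (x y : EuclideanSpace ℝ (Fin n)) :
    |u x - u y| ≤ n * K * ‖x - y‖ := by
  have key : ∀ S : Finset (Fin n),
      |u (y + ∑ j ∈ S, (x - y) j • EuclideanSpace.single j (1:ℝ)) - u y|
        ≤ ∑ j ∈ S, K * |(x - y) j| := by
    intro S
    induction S using Finset.induction_on with
    | empty => simp
    | insert j S hj ih =>
      rw [Finset.sum_insert hj, Finset.sum_insert hj, add_comm (_ • _), ← add_assoc]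
      exact (abs_sub_le _ _ _).trans
        (add_le_add (abs_sub_le_of_partialDeriv_single (hd j) (hK j) _ _) ih)
  have h := key Finset.univ
  rw [EuclideanSpace.sum_single_eq, add_sub_cancel] at h
  refine h.trans ?_
  have hle : ∀ j, K * |(x - y) j| ≤ K * ‖x - y‖ := fun j =>
    mul_le_mul_of_nonneg_left (PiLp.norm_apply_le (x - y) j) ((abs_nonneg _).trans (hK j x))
  refine (Finset.sum_le_sum fun j _ => hle j).trans_eq ?_
  simp [mul_assoc]

/-- The first-order bound is used twice: on `z ↦ u (z + v) - u z`, and on each `∂ⱼ u` to bound the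
partial derivatives of that difference by `n K ‖v‖`. -/
theorem abs_second_difference_le (hd : ∀ j, HasPartialDeriv j u)
    (hd2 : ∀ j k, HasPartialDeriv k (partialDeriv j u))
    (hK : ∀ j k x, |partialDeriv k (partialDeriv j u) x| ≤ K)
    (x y v : EuclideanSpace ℝ (Fin n)) :
    |u (x + v) - u x - (u (y + v) - u y)| ≤ n * (n * K * ‖v‖) * ‖x - y‖ := by
  have hdv : ∀ j z, HasLineDerivAt ℝ (fun z => u (z + v) - u z)
      (partialDeriv j u (z + v) - partialDeriv j u z) z (EuclideanSpace.single j 1) := fun j z => by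
    have h1 := (hd j (z + v)).hasLineDerivAt
    have h2 := (hd j z).hasLineDerivAt
    refine (HasDerivAt.sub h1 h2).congr_of_eventuallyEq (Eventually.of_forall fun t => ?_)
    simp only [Pi.sub_apply, add_right_comm]
  refine abs_sub_le_of_partialDeriv (u := fun z => u (z + v) - u z)
    (fun j z => (hdv j z).lineDifferentiableAt) (fun j z => ?_) x y
  have h3 : partialDeriv j (fun z => u (z + v) - u z) z
      = partialDeriv j u (z + v) - partialDeriv j u z := (hdv j z).lineDeriv
  rw [h3]
  have h4 := abs_sub_le_of_partialDeriv (hd2 j) (hK j) (z + v) z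
  rwa [add_sub_cancel_left] at h4

end PartialDerivatives

/-- Almost every section `f x` is measurable in time. Choosing countably many such `x`, dense in
space, and discarding one null set of times makes these sections Borel; continuity in `x` extends
this to all `x` and then to joint measurability. The discarded times do not depend on `x`, so they
do not matter along any trajectory. -/
theorem exists_measurable_modification {n : ℕ} {α : Type*} [MeasurableSpace α] {μ : Measure α}
    [SFinite μ] {f : EuclideanSpace ℝ (Fin n) → α → EuclideanSpace ℝ (Fin n)}
    (hcont : ∀ᵐ t ∂μ, Continuous fun x => f x t)
    (hmeas : ∀ i, AEMeasurable (fun z : EuclideanSpace ℝ (Fin n) × α => f z.1 z.2 i)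
      (volume.prod μ)) :
    ∃ A : Set α, MeasurableSet A ∧ (∀ᵐ t ∂μ, t ∈ A) ∧
      Measurable fun z : α × EuclideanSpace ℝ (Fin n) => A.indicator (f z.2) z.1 := by
  have hgood : ∀ᵐ x : EuclideanSpace ℝ (Fin n), AEMeasurable (f x) μ := by
    have h1 : ∀ᵐ x : EuclideanSpace ℝ (Fin n), ∀ i,
        AEStronglyMeasurable (fun t => f x t i) μ :=
      ae_all_iff.2 fun i => (hmeas i).aestronglyMeasurable.prodMk_left
    filter_upwards [h1] with x hx
    have h2 : AEMeasurable (fun t i => f x t i) μ :=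
      aemeasurable_pi_iff.2 fun i => (hx i).aemeasurable
    exact (WithLp.measurable_toLp 2 (Fin n → ℝ)).comp_aemeasurable h2
  obtain ⟨D, hDsub, hDc, hDd⟩ := (Measure.dense_of_ae hgood).exists_countable_dense_subset
  have hDm : ∀ x : D, AEMeasurable (f x) μ := fun x => hDsub x.2
  have : Countable D := hDc.to_subtype
  have hae : ∀ᵐ t ∂μ, (∀ x : D, f x t = (hDm x).mk _ t) ∧ Continuous fun x => f x t :=
    (ae_all_iff.2 fun x => (hDm x).ae_eq_mk).and hcont
  obtain ⟨N, hNsub, hNm, hN0⟩ := exists_measurable_superset_of_null (ae_iff.1 hae)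
  have hA : ∀ t ∈ Nᶜ, (∀ x : D, f x t = (hDm x).mk _ t) ∧ Continuous fun x => f x t :=
    fun t ht => by_contra fun h => ht (hNsub h)
  refine ⟨Nᶜ, hNm.compl, measure_eq_zero_iff_ae_notMem.1 hN0, ?_⟩
  have hFc : ∀ t, Continuous fun x => (Nᶜ).indicator (f x) t := fun t => by
    by_cases ht : t ∈ Nᶜ
    · simpa only [indicator_of_mem ht] using (hA t ht).2
    · simpa only [indicator_of_notMem ht] using continuous_const
  have hFm : ∀ x, Measurable ((Nᶜ).indicator (f x)) := fun x => by
    obtain ⟨d, hd, hlim⟩ := mem_closure_iff_seq_limit.1 (hDd x)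
    refine measurable_of_tendsto_metrizable (f := fun k => (Nᶜ).indicator (f (d k)))
      (fun k => ?_) ?_
    · have e : (Nᶜ).indicator (f (d k)) = (Nᶜ).indicator ((hDm ⟨d k, hd k⟩).mk _) :=
        indicator_congr fun t ht => (hA t ht).1 ⟨d k, hd k⟩
      rw [e]
      exact (hDm ⟨d k, hd k⟩).measurable_mk.indicator hNm.compl
    · rw [tendsto_pi_nhds]
      exact fun t => ((hFc t).tendsto x).comp hlim
  exact (measurable_uncurry_of_continuous_of_measurable hFc hFm).comp measurable_swap

/-- A regular field agrees, at almost all times, with a tame field. -/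
theorem IsRegularField.exists_isTameField {n : ℕ} {T : ℝ}
    {f : EuclideanSpace ℝ (Fin n) → ℝ → EuclideanSpace ℝ (Fin n)} (hf : IsRegularField T f) :
    ∃ (F : ℝ → EuclideanSpace ℝ (Fin n) → EuclideanSpace ℝ (Fin n)) (M L L₂ : ℝ),
      IsTameField F M L L₂ ∧ ∀ᵐ t ∂(volume.restrict (Icc 0 T)), ∀ x, f x t = F t x := by
  obtain ⟨K₀, hK₀⟩ := hf.bdd
  set K := max K₀ 0 with hK
  have hK0 : 0 ≤ K := le_max_right _ _
  have hKK : K₀ ≤ K := le_max_left _ _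
  have hb0 : ∀ t ∈ Icc 0 T, ∀ x, ‖f x t‖ ≤ n * K := fun t ht x =>
    EuclideanSpace.norm_le_of_forall_abs_le fun i => ((hK₀ t ht x).1 i).trans hKK
  have hb1 : ∀ t ∈ Icc 0 T, ∀ x y, ‖f x t - f y t‖ ≤ (n * (n * K)) * ‖x - y‖ := fun t ht x y => by
    rw [mul_assoc]
    refine EuclideanSpace.norm_le_of_forall_abs_le fun i => ?_
    exact abs_sub_le_of_partialDeriv (u := fun x => f x t i) (hf.diff_one t ht i)
      (fun j x => ((hK₀ t ht x).2.1 i j).trans hKK) x y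
  have hb2 : ∀ t ∈ Icc 0 T, ∀ x y v, ‖f (x + v) t - f x t - (f (y + v) t - f y t)‖
      ≤ (n * (n * (n * K))) * ‖v‖ * ‖x - y‖ := fun t ht x y v => by
    refine (EuclideanSpace.norm_le_of_forall_abs_le fun i => ?_).trans_eq
      (by ring : (n : ℝ) * (n * (n * K * ‖v‖) * ‖x - y‖) = _)
    exact abs_second_difference_le (u := fun x => f x t i) (hf.diff_one t ht i)
      (hf.diff_two t ht i) (fun j k x => ((hK₀ t ht x).2.2 i j k).trans hKK) x y v
  have hcont : ∀ᵐ t ∂(volume.restrict (Icc 0 T)), Continuous fun x => f x t := by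
    filter_upwards [ae_restrict_mem measurableSet_Icc] with t ht
    exact (LipschitzWith.of_dist_le_mul (K := (n * (n * K)).toNNReal) fun x y => by
      rw [Real.coe_toNNReal _ (by positivity), dist_eq_norm, dist_eq_norm]
      exact hb1 t ht x y).continuous
  have hmeas : ∀ i, AEMeasurable (fun z : EuclideanSpace ℝ (Fin n) × ℝ => f z.1 z.2 i)
      (volume.prod (volume.restrict (Icc 0 T))) := fun i => by
    have := hf.meas_zero i
    rwa [Measure.volume_eq_prod, ← Measure.prod_restrict, Measure.restrict_univ] at this
  obtain ⟨A, hAm, hAae, hFm⟩ := exists_measurable_modification hcont hmeas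
  have hmem : ∀ t ∉ A ∩ Icc 0 T, ∀ x, (A ∩ Icc 0 T).indicator (f x) t = 0 := fun t ht x =>
    indicator_of_notMem ht _
  -- Setting the field to zero at the remaining times makes the bounds hold for every real `t`, so
  -- the flow is global.
  refine ⟨fun t x => (A ∩ Icc 0 T).indicator (f x) t, n * K, n * (n * K), n * (n * (n * K)),
    ⟨by positivity, by positivity, fun t x => ?_, fun t x y => ?_, fun t x y v => ?_, ?_⟩, ?_⟩
  · by_cases ht : t ∈ A ∩ Icc 0 T
    · rw [indicator_of_mem ht]; exact hb0 t ht.2 x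
    · rw [hmem t ht, norm_zero]; positivity
  · by_cases ht : t ∈ A ∩ Icc 0 T
    · rw [indicator_of_mem ht, indicator_of_mem ht]; exact hb1 t ht.2 x y
    · rw [hmem t ht, hmem t ht, sub_zero, norm_zero]; positivity
  · by_cases ht : t ∈ A ∩ Icc 0 T
    · simp only [indicator_of_mem ht]; exact hb2 t ht.2 x y v
    · simp only [hmem t ht, sub_zero, norm_zero]; positivity
  · have e : (fun z : ℝ × EuclideanSpace ℝ (Fin n) => (A ∩ Icc 0 T).indicator (f z.2) z.1)
        = (Prod.fst ⁻¹' Icc 0 T).indicator fun z => A.indicator (f z.2) z.1 := by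
      ext1 z
      rw [inter_comm, ← indicator_indicator]
      rfl
    rw [e]
    exact hFm.indicator (measurable_fst measurableSet_Icc)
  · filter_upwards [hAae, ae_restrict_mem measurableSet_Icc] with t h1 h2 x
    exact (indicator_of_mem (s := A ∩ Icc 0 T) ⟨h1, h2⟩ (f x)).symm

/-! ### Trajectories of the original field. -/

namespace IsTameField

variable {n : ℕ} {F : ℝ → EuclideanSpace ℝ (Fin n) → EuclideanSpace ℝ (Fin n)} {M L L₂ : ℝ}
  {f : EuclideanSpace ℝ (Fin n) → ℝ → EuclideanSpace ℝ (Fin n)} {s T : ℝ}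

theorem ae_uIoc_of_ae_Icc (hf : ∀ᵐ t ∂(volume.restrict (Icc s T)), ∀ x, f x t = F t x) {t : ℝ}
    (ht : t ∈ Icc s T) : ∀ᵐ r, r ∈ uIoc s t → ∀ x, f x r = F r x := by
  rw [← ae_restrict_iff' measurableSet_uIoc]
  refine ae_restrict_of_ae_restrict_of_subset ?_ hf
  rw [uIoc_of_le ht.1]
  exact Ioc_subset_Icc_self.trans (Icc_subset_Icc_right ht.2)

theorem isTrajectory_flow (hF : IsTameField F M L L₂) (hsT : s ≤ T)
    (hf : ∀ᵐ t ∂(volume.restrict (Icc s T)), ∀ x, f x t = F t x)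
    (x : EuclideanSpace ℝ (Fin n)) : IsTrajectory f s T x fun t => hF.flow s t x := by
  refine ⟨(hF.continuous_flow_time s x).continuousOn, ?_, fun t ht => ?_⟩
  · refine (hF.integrable_along_flow s x s T).congr_ae ?_
    filter_upwards [(ae_restrict_iff' measurableSet_uIoc).2
      (ae_uIoc_of_ae_Icc hf (right_mem_Icc.2 hsT))] with r hr
    exact (hr _).symm
  · refine (hF.flow_eq s t x).trans ?_
    congr 1
    refine intervalIntegral.integral_congr_ae ?_
    filter_upwards [ae_uIoc_of_ae_Icc hf ht] with r hr hrm
    exact (hr hrm _).symm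

theorem eq_flow_of_isTrajectory (hF : IsTameField F M L L₂)
    (hf : ∀ᵐ t ∂(volume.restrict (Icc s T)), ∀ x, f x t = F t x)
    {x : EuclideanSpace ℝ (Fin n)} {y : ℝ → EuclideanSpace ℝ (Fin n)}
    (hy : IsTrajectory f s T x y) {t : ℝ} (ht : t ∈ Icc s T) : y t = hF.flow s t x := by
  obtain ⟨hyc, -, hye⟩ := hy
  have hsT : s ≤ T := ht.1.trans ht.2
  -- Nothing is known about `y` outside `[s, T]`; the constant extension supplies the continuity on
  -- the whole line required for comparison with the flow.
  set z : ℝ → EuclideanSpace ℝ (Fin n) := IccExtend hsT fun r : Icc s T => y r with hz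
  have hzc : Continuous z := (continuousOn_iff_continuous_domRestrict.1 hyc).Icc_extend'
  have hzy : ∀ r ∈ Icc s T, z r = y r := fun r hr => IccExtend_of_mem hsT _ hr
  rw [← hzy t ht]
  refine hF.eq_flow_of_integralCurve hzc fun r hr => ?_
  rw [uIcc_of_le ht.1] at hr
  have hr' : r ∈ Icc s T := ⟨hr.1, hr.2.trans ht.2⟩
  rw [hzy r hr', hye r hr']
  congr 1
  refine intervalIntegral.integral_congr_ae ?_
  filter_upwards [ae_uIoc_of_ae_Icc hf hr'] with u hu hum
  rw [uIoc_of_le hr.1] at hum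
  rw [hzy u ⟨hum.1.le, hum.2.trans hr'.2⟩, hu (by rwa [uIoc_of_le hr.1])]

end IsTameField

/-! ### Transfer operators and probability densities. -/

section Density

variable {n : ℕ} {X : EuclideanSpace ℝ (Fin n) → EuclideanSpace ℝ (Fin n)} {C : ℝ≥0}

/-- Adjointness tested on the indicator of `B`, which lies in `L₂` because `B` has finite volume. -/
theorem HasBoundedCompression.setIntegral_transfer (hX : HasBoundedCompression X C) (ρ : H0 n)
    {B : Set (EuclideanSpace ℝ (Fin n))} (hB : MeasurableSet B) (hB' : volume B ≠ ⊤) :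
    ∫ x in B, hX.transfer ρ x = ∫ x in X ⁻¹' B, ρ x := by
  have h1 : MemLp (B.indicator fun _ => (1:ℝ)) 2 (volume : Measure (EuclideanSpace ℝ (Fin n))) :=
    memLp_indicator_const _ hB _ (Or.inr hB')
  have h2 := hX.inner_transfer_toLp ρ h1
  rw [H0.inner_toLp_right] at h2
  rw [← integral_indicator hB, ← integral_indicator (hX.measurable hB)]
  have e1 : B.indicator (hX.transfer ρ)
      = fun x => hX.transfer ρ x * B.indicator (fun _ => (1:ℝ)) x := by
    ext x; by_cases hx : x ∈ B <;> simp [hx]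
  have e2 : (X ⁻¹' B).indicator ρ = fun x => ρ x * B.indicator (fun _ => (1:ℝ)) (X x) := by
    ext x; by_cases hx : X x ∈ B <;> simp [indicator, hx]
  rw [e1, e2, h2]

theorem HasBoundedCompression.hasDensity_transfer (hX : HasBoundedCompression X C) {Ω : Type*}
    [MeasurableSpace Ω] {P : Measure Ω} {a : Ω → EuclideanSpace ℝ (Fin n)} {ρ : H0 n}
    (ha : HasDensity P a ρ) : HasDensity P (fun e => X (a e)) (hX.transfer ρ) := by
  obtain ⟨ham, hρ, hmap⟩ := ha
  have hXB : ∀ B, MeasurableSet B → volume B ≠ ⊤ → volume (X ⁻¹' B) ≠ ⊤ := fun B hB hB' => by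
    rw [← Measure.map_apply hX.measurable hB]
    refine ((hX.map_le B).trans_lt ?_).ne
    rw [Measure.smul_apply, smul_eq_mul]
    exact ENNReal.mul_lt_top ENNReal.coe_lt_top hB'.lt_top
  have hint : ∀ (v : H0 n) (B : Set (EuclideanSpace ℝ (Fin n))), volume B ≠ ⊤ →
      IntegrableOn v B := fun v B hB =>
    integrableOn_Lp_of_measure_ne_top v (by norm_num) hB
  have hpos : ∀ᵐ x, 0 ≤ hX.transfer ρ x := by
    refine ae_nonneg_of_forall_setIntegral_nonneg_of_sigmaFinite
      (fun B _ hB' => hint _ B hB'.ne) fun B hB hB' => ?_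
    rw [hX.setIntegral_transfer ρ hB hB'.ne]
    exact integral_nonneg_of_ae (ae_restrict_of_ae hρ)
  refine ⟨hX.measurable.comp ham, hpos, ?_⟩
  have key : ∀ B, MeasurableSet B → volume B ≠ ⊤ → P.map (fun e => X (a e)) B
      = volume.withDensity (fun x => ENNReal.ofReal (hX.transfer ρ x)) B := fun B hB hB' => by
    have e : P.map (fun e => X (a e)) = (P.map a).map X := (Measure.map_map hX.measurable ham).symm
    rw [e, Measure.map_apply hX.measurable hB, hmap, withDensity_apply _ (hX.measurable hB),
      withDensity_apply _ hB, ← ofReal_integral_eq_lintegral_ofReal (hint ρ _ (hXB B hB hB'))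
        (ae_restrict_of_ae hρ), ← ofReal_integral_eq_lintegral_ofReal (hint _ B hB')
        (ae_restrict_of_ae hpos), hX.setIntegral_transfer ρ hB hB']
  -- The two measures are known to agree only on sets of finite volume; a countable exhaustion by
  -- such sets gives equality.
  rw [Measure.ext_iff_of_iUnion_eq_univ
    (iUnion_spanningSets (volume : Measure (EuclideanSpace ℝ (Fin n))))]
  intro k
  ext B hB
  rw [Measure.restrict_apply hB, Measure.restrict_apply hB]
  exact key _ (hB.inter (measurableSet_spanningSets _ _))
    ((measure_mono inter_subset_right).trans_lt (measure_spanningSets_lt_top _ k)).ne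

end Density

end

/-! ### The theorem. -/

theorem theorem1p2 {n : ℕ} {s T : ℝ} (hT : 0 < T) (hs : 0 ≤ s) (hsT : s ≤ T)
    (f : EuclideanSpace ℝ (Fin n) → ℝ → EuclideanSpace ℝ (Fin n))
    (hf : IsRegularField T f) :
    (∃! Λ : H0 n →L[ℝ] C(Set.Icc s T, H0 n), IsForwardOperator f hsT Λ) ∧
    (∀ x : EuclideanSpace ℝ (Fin n), ∃ y : ℝ → EuclideanSpace ℝ (Fin n),
      IsTrajectory f s T x y ∧
      ∀ y' : ℝ → EuclideanSpace ℝ (Fin n), IsTrajectory f s T x y' →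
        Set.EqOn y' y (Set.Icc s T)) ∧
    (∀ Λ : H0 n →L[ℝ] C(Set.Icc s T, H0 n), IsForwardOperator f hsT Λ →
      ∀ (Ω : Type*) [MeasurableSpace Ω] (P : Measure Ω) [IsProbabilityMeasure P]
        (a : Ω → EuclideanSpace ℝ (Fin n)) (ρ : H0 n),
        HasDensity P a ρ →
        ∀ y : Ω → ℝ → EuclideanSpace ℝ (Fin n),
          (∀ e, IsTrajectory f s T (a e) (y e)) →
          ∀ t : Set.Icc s T, HasDensity P (fun e => y e t) (Λ ρ t)) := by
  obtain ⟨F, M, L, L₂, hF, hfF⟩ := hf.exists_isTameField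
  have hae : ∀ᵐ t ∂(volume.restrict (Set.Icc s T)), ∀ x, f x t = F t x :=
    ae_restrict_of_ae_restrict_of_subset (Set.Icc_subset_Icc_left hs) hfF
  have hsol : ∀ ρ : H0 n, MemH1 ρ → IsForwardSolution f hsT ρ (hF.forwardOperator s T ρ) :=
    fun ρ hρ => hF.isForwardSolution_forwardOperator hsT hae hρ
  have hop : IsForwardOperator f hsT (hF.forwardOperator s T) := fun ρ hρ p =>
    ⟨fun hp => hF.forwardSolution_unique hsT hae hp (hsol ρ hρ), fun hp => hp ▸ hsol ρ hρ⟩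
  -- Any such operator is determined on test functions, which belong to `H¹` and are dense in `L₂`.
  have huniq : ∀ Λ : H0 n →L[ℝ] C(Set.Icc s T, H0 n), IsForwardOperator f hsT Λ →
      Λ = hF.forwardOperator s T := fun Λ hΛ => by
    refine DFunLike.coe_injective (Continuous.ext_on (dense_testSubmodule n) Λ.continuous
      (hF.forwardOperator s T).continuous fun ρ hρ => ?_)
    have hρ' := memH1_of_mem_testSubmodule hρ
    exact ((hΛ ρ hρ' _).1 (hsol ρ hρ')).symm
  refine ⟨⟨hF.forwardOperator s T, hop, huniq⟩, fun x =>
    ⟨fun t => hF.flow s t x, hF.isTrajectory_flow hsT hae x,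
      fun y' hy' t ht => hF.eq_flow_of_isTrajectory hae hy' ht⟩, ?_⟩
  intro Λ hΛ Ω _ P _ a ρ ha y hy t
  rw [huniq Λ hΛ, hF.forwardOperator_apply]
  have e : (fun e => y e t) = fun e => hF.flow s t (a e) :=
    funext fun e => hF.eq_flow_of_isTrajectory hae (hy e) t.2
  rw [e]
  exact (hF.hasBoundedCompression_flow s t).hasDensity_transfer ha
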